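/- Let $\mu_1,\mu_2,\mu_3$ be real numbers with $\mu_i>-1/2$. For $i=1,2,3$ let $R_i$ be the reflection of $\mathbb{R}^3$ in the plane $x_i=0$, let $$\mathcal{D}_i=\partial_{x_i}+\frac{\mu_i}{x_i}(1-R_i)$$ be the Dunkl operators (where $(F-R_iF)/x_i$ is given its limit value $2\,\partial_{x_i}F$ on the plane $x_i=0$), and let $\Delta=\mathcal{D}_1^2+\mathcal{D}_2^2+\mathcal{D}_3^2$ be the $\mathbb{Z}_2^3$ Dunkl Laplacian. Let $\Delta_{S^2}$ be its angular part on the unit sphere $S^2\subset\mathbb{R}^3$: for a function $f$ on $S^2$, $\Delta_{S^2}f$ is the restriction to $S^2$ of $\Delta F$, where $F(x)=f(x/|x|)$ for $x\neq 0$. Let $n\in\{2,3,\dots,\infty,\omega\}$ be an order of differentiability ($\omega$ meaning real-analytic). Call $\delta\in\mathbb{C}$ an eigenvalue of $\Delta_{S^2}$ if there is a function $f:S^2\to\mathbb{C}$ of class $C^n$, not identically zero, with $\Delta_{S^2}f=\delta f$ on $S^2$. Then the set of eigenvalues of $\Delta_{S^2}$ is exactly $$\{\delta_N : N=0,1,2,\dots\},\qquad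 \delta_{N}=-N(N+2\mu_1+2\mu_2+2\mu_3+1).$$ -/

import Mathlib

open scoped Manifold ContDiff

noncomputable section

namespace DunklSphere

/-- Euclidean three-space. -/
abbrev E3 : Type := EuclideanSpace ℝ (Fin 3)

/-- The unit sphere of Euclidean three-space. -/
abbrev S2 : Type := Metric.sphere (0 : E3) 1

/-- Three-space has dimension `2 + 1`; this gives `S2` Mathlib's manifold structure. -/
instance finrank_E3 : Fact (Module.finrank ℝ E3 = 2 + 1) := ⟨by simp [E3]⟩

/-- The reflection of three-space in the plane `x i = 0`. -/
def reflect (i : Fin 3) (x : E3) : E3 :=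
  WithLp.toLp 2 (Function.update x.ofLp i (-(x i)))

/-- The partial derivative with respect to the `i`-th coordinate. -/
def partialDeriv (i : Fin 3) (F : E3 → ℂ) (x : E3) : ℂ :=
  fderiv ℝ F x (EuclideanSpace.single i 1)

/-- The difference quotient `(F x - F (R_i x)) / x i`, with its limit `2 ∂_i F x` as value on
the plane `x i = 0`, where the quotient has a removable singularity. -/
def reflQuot (i : Fin 3) (F : E3 → ℂ) (x : E3) : ℂ :=
  if x i = 0 then 2 * partialDeriv i F x else (F x - F (reflect i x)) / (x i : ℂ)

/-- The Dunkl operator `∂_i + (μ_i / x_i) (1 - R_i)`. -/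
def dunklD (μ : Fin 3 → ℝ) (i : Fin 3) (F : E3 → ℂ) (x : E3) : ℂ :=
  partialDeriv i F x + (μ i : ℂ) * reflQuot i F x

/-- The Dunkl Laplacian `D_1 ^ 2 + D_2 ^ 2 + D_3 ^ 2` on three-space. -/
def dunklLaplacian (μ : Fin 3 → ℝ) (F : E3 → ℂ) (x : E3) : ℂ :=
  ∑ i : Fin 3, dunklD μ i (dunklD μ i F) x

/-- The radial projection of a nonzero vector to the unit sphere. -/
def proj (x : E3) (hx : x ≠ 0) : S2 :=
  ⟨‖x‖⁻¹ • x, by simp [norm_smul, hx]⟩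

open Classical in
/-- The extension of a function on the sphere that is constant on open rays from the origin
(the value at the origin plays no role). -/
def radialExt (f : S2 → ℂ) (x : E3) : ℂ :=
  if hx : x = 0 then 0 else f (proj x hx)

/-- The angular part of the Dunkl Laplacian, as an operator on functions on the sphere: in
spherical coordinates the Dunkl Laplacian is
`∂_r ^ 2 + (2 / r) (1 + μ_1 + μ_2 + μ_3) ∂_r + (1 / r ^ 2) Δ_{S^2}`, so that `Δ_{S^2} f` is the
value at `r = 1` of the Dunkl Laplacian of the extension of `f` that does not depend on `r`. -/
def dunklLaplacianS2 (μ : Fin 3 → ℝ) (f : S2 → ℂ) (ξ : S2) : ℂ :=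
  dunklLaplacian μ (radialExt f) (ξ : E3)

/-- `δ` is an eigenvalue of the Dunkl Laplacian on the sphere: there is a complex-valued
function of class `C^n` on the sphere, not identically zero, with `Δ_{S^2} f = δ f`. -/
def IsEigenvalueS2 (μ : Fin 3 → ℝ) (n : WithTop ℕ∞) (δ : ℂ) : Prop :=
  ∃ f : S2 → ℂ, ContMDiff (𝓡 2) 𝓘(ℝ, ℂ) n f ∧ f ≠ 0 ∧
    ∀ ξ : S2, dunklLaplacianS2 μ f ξ = δ * f ξ

end DunklSphere

end

noncomputable section

namespace DunklSphere

open MeasureTheory Filter Set Topology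

/-! Write `S = μ_1 + μ_2 + μ_3`. The weight `w = ∏ |x_i| ^ (2 μ_i)` is locally integrable because
`μ_i > -1/2`, and each Dunkl operator is skew-symmetric for `w dx` (`wint_dunklD_mul`), so the Dunkl
Laplacian is symmetric.

Every eigenvalue is some `δ_N`: extend an eigenfunction to be constant on rays and cut it off
radially to get `F`. On a spherical shell `F` satisfies `|x|² Δ F = δ F` and is annihilated by the
Euler operator (`IsShellEigen`). Pair `F` with `x^a χ(|x|²)`, where `|a| = N` and `χ(|x|²)` is
supported in the shell. Symmetry of `Δ` (`moment_laplacian`) expresses `δ` times this moment through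
moments of degree `N - 2` and moments of the same monomial with `t χ'` or `t (t χ')'` in place of
`χ`. Integrating the Euler operator by parts (`moment_euler`) turns the latter into multiples of the
original moment, which leaves `(δ - δ_N) · moment = lower moments`. If `δ` is no `δ_N`, induction on
the degree kills all moments (`moment_eq_zero`), and Stone–Weierstrass forces `F = 0` on a sphere
(`eq_zero_of_wint_mono_eq_zero`). No decomposition of polynomials into harmonics is needed.

Every `δ_N` occurs: an explicit homogeneous polynomial of degree `N` killed by `Δ` (`harm`)
restricts to an eigenfunction. Its extension constant on rays is `|x|^(-N)` times the polynomial,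
and `dunklLaplacian_radial_mul` computes the Laplacian of such a product. -/

/-- The reflection in a coordinate plane as a linear isometry. -/
def reflectLI (i : Fin 3) : E3 ≃ₗᵢ[ℝ] E3 :=
  LinearIsometryEquiv.piLpCongrRight 2
    (fun j => if j = i then LinearIsometryEquiv.neg ℝ else LinearIsometryEquiv.refl ℝ ℝ)

lemma reflectLI_apply (i : Fin 3) (x : E3) : reflectLI i x = reflect i x := by
  ext j
  by_cases h : j = i
  · subst h; simp [reflectLI, reflect]
  · simp [reflectLI, reflect, h]

lemma coe_reflectLI (i : Fin 3) : ⇑(reflectLI i) = reflect i := funext (reflectLI_apply i)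

lemma reflect_same (i : Fin 3) (x : E3) : reflect i x i = -x i := by simp [reflect]

lemma reflect_ne {i j : Fin 3} (h : j ≠ i) (x : E3) : reflect i x j = x j := by
  simp [reflect, h]

lemma norm_reflect (i : Fin 3) (x : E3) : ‖reflect i x‖ = ‖x‖ := by
  rw [← reflectLI_apply]; exact (reflectLI i).norm_map x

lemma reflect_reflect (i : Fin 3) (x : E3) : reflect i (reflect i x) = x := by
  ext j
  by_cases h : j = i
  · subst h; simp [reflect]
  · simp [reflect]

lemma reflect_of_eq_zero {i : Fin 3} {x : E3} (h : x i = 0) : reflect i x = x := by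
  ext j
  by_cases hj : j = i
  · subst hj; simp [reflect, h]
  · simp [reflect, hj]

lemma continuous_reflect (i : Fin 3) : Continuous (reflect i) := by
  rw [← coe_reflectLI]; exact (reflectLI i).continuous

lemma reflect_smul (i : Fin 3) (c : ℝ) (x : E3) : reflect i (c • x) = c • reflect i x := by
  simp only [← reflectLI_apply, map_smul]

lemma reflect_eq_add_smul (i : Fin 3) (x : E3) :
    reflect i x = x + (-2 * x i) • EuclideanSpace.single i (1 : ℝ) := by
  ext j
  by_cases hj : j = i
  · subst hj; simp [reflect]; ring
  · simp [reflect, hj]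

lemma contDiff_coord (i : Fin 3) {n : WithTop ℕ∞} : ContDiff ℝ n (fun x : E3 => x i) := by
  fun_prop

lemma contDiff_coordC (i : Fin 3) {n : WithTop ℕ∞} :
    ContDiff ℝ n (fun x : E3 => ((x i : ℝ) : ℂ)) :=
  Complex.ofRealCLM.contDiff.comp (contDiff_coord i)

/-! ### Partial derivatives -/

lemma contDiff_partialDeriv (i : Fin 3) {F : E3 → ℂ} {n m : WithTop ℕ∞} (hF : ContDiff ℝ n F)
    (h : m + 1 ≤ n) : ContDiff ℝ m (partialDeriv i F) := by
  unfold partialDeriv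
  exact (hF.fderiv_right h).clm_apply contDiff_const

lemma partialDeriv_add (i : Fin 3) {F G : E3 → ℂ} {x : E3} (hF : DifferentiableAt ℝ F x)
    (hG : DifferentiableAt ℝ G x) :
    partialDeriv i (fun y => F y + G y) x = partialDeriv i F x + partialDeriv i G x := by
  simp [partialDeriv, fderiv_fun_add hF hG]

lemma partialDeriv_mul (i : Fin 3) {F G : E3 → ℂ} {x : E3} (hF : DifferentiableAt ℝ F x)
    (hG : DifferentiableAt ℝ G x) :
    partialDeriv i (fun y => F y * G y) x
      = F x * partialDeriv i G x + partialDeriv i F x * G x := by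
  simp [partialDeriv, fderiv_fun_mul hF hG, mul_comm]

lemma partialDeriv_const (i : Fin 3) (c : ℂ) (x : E3) :
    partialDeriv i (fun _ => c) x = 0 := by
  simp [partialDeriv]

lemma partialDeriv_coord (i j : Fin 3) (x : E3) :
    partialDeriv i (fun y : E3 => ((y j : ℝ) : ℂ)) x = if j = i then 1 else 0 := by
  have h : HasFDerivAt (fun y : E3 => ((y j : ℝ) : ℂ))
      (Complex.ofRealCLM.comp (EuclideanSpace.proj j)) x :=
    (Complex.ofRealCLM.comp (EuclideanSpace.proj j : E3 →L[ℝ] ℝ)).hasFDerivAt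
  unfold partialDeriv
  rw [h.fderiv]
  by_cases hj : j = i <;> simp [hj]

lemma fderiv_self_eq_sum (F : E3 → ℂ) (x : E3) :
    fderiv ℝ F x x = ∑ i, (x i : ℂ) * partialDeriv i F x := by
  have hx : x = ∑ i, x i • EuclideanSpace.single i (1 : ℝ) := by
    ext j
    simp [Finset.sum_apply, Pi.single_apply]
  conv_lhs => rw [show fderiv ℝ F x x = fderiv ℝ F x (∑ i, x i • EuclideanSpace.single i (1 : ℝ))
    from congrArg _ hx]
  simp [partialDeriv, map_sum]

/-! ### Locality -/

lemma partialDeriv_congr (i : Fin 3) {F G : E3 → ℂ} {x : E3} (h : F =ᶠ[𝓝 x] G) :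
    partialDeriv i F x = partialDeriv i G x := by
  simp [partialDeriv, h.fderiv_eq]

/-- Dunkl operators are not local, but reflections preserve the norm, so they are local with respect
to open unions of spheres centred at the origin. -/
lemma dunklD_congr (μ : Fin 3 → ℝ) (i : Fin 3) {F G : E3 → ℂ} {s : Set ℝ} (hs : IsOpen s)
    (h : ∀ x : E3, ‖x‖ ∈ s → F x = G x) {x : E3} (hx : ‖x‖ ∈ s) :
    dunklD μ i F x = dunklD μ i G x := by
  have hp : partialDeriv i F x = partialDeriv i G x := by
    apply partialDeriv_congr
    filter_upwards [(hs.preimage continuous_norm).mem_nhds hx] with y hy using h y hy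
  unfold dunklD reflQuot
  rw [hp, h x hx, h (reflect i x) (by rwa [norm_reflect])]

lemma dunklLaplacian_congr (μ : Fin 3 → ℝ) {F G : E3 → ℂ} {s : Set ℝ} (hs : IsOpen s)
    (h : ∀ x : E3, ‖x‖ ∈ s → F x = G x) {x : E3} (hx : ‖x‖ ∈ s) :
    dunklLaplacian μ F x = dunklLaplacian μ G x :=
  Finset.sum_congr rfl fun i _ =>
    dunklD_congr μ i hs (fun _ hy => dunklD_congr μ i hs h hy) hx

lemma dunklD_zero (μ : Fin 3 → ℝ) (i : Fin 3) (x : E3) : dunklD μ i (fun _ => 0) x = 0 := by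
  simp [dunklD, reflQuot, partialDeriv]

/-! ### Functions of bounded support -/

/-- `F` vanishes outside some ball. -/
def BddSupp (F : E3 → ℂ) : Prop := ∃ R : ℝ, ∀ x, R < ‖x‖ → F x = 0

lemma BddSupp.dunklD {F : E3 → ℂ} (hF : BddSupp F) (μ : Fin 3 → ℝ) (i : Fin 3) :
    BddSupp (dunklD μ i F) := by
  obtain ⟨R, hR⟩ := hF
  refine ⟨R, fun x hx => ?_⟩
  rw [dunklD_congr μ i (G := fun _ => 0) isOpen_Ioi (fun y hy => hR y hy) hx, dunklD_zero]

lemma BddSupp.mul_left {F : E3 → ℂ} (hF : BddSupp F) (G : E3 → ℂ) :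
    BddSupp (fun x => G x * F x) := by
  obtain ⟨R, hR⟩ := hF
  exact ⟨R, fun x hx => by simp [hR x hx]⟩

lemma BddSupp.mul_right {F : E3 → ℂ} (hF : BddSupp F) (G : E3 → ℂ) :
    BddSupp (fun x => F x * G x) := by
  obtain ⟨R, hR⟩ := hF
  exact ⟨R, fun x hx => by simp [hR x hx]⟩

lemma BddSupp.add {F G : E3 → ℂ} (hF : BddSupp F) (hG : BddSupp G) :
    BddSupp (fun x => F x + G x) := by
  obtain ⟨R, hR⟩ := hF
  obtain ⟨R', hR'⟩ := hG
  exact ⟨max R R', fun x hx => by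
    simp [hR x (lt_of_le_of_lt (le_max_left _ _) hx), hR' x (lt_of_le_of_lt (le_max_right _ _) hx)]⟩

lemma BddSupp.comp_reflect {F : E3 → ℂ} (hF : BddSupp F) (i : Fin 3) :
    BddSupp (fun x => F (reflect i x)) := by
  obtain ⟨R, hR⟩ := hF
  exact ⟨R, fun x hx => hR _ (by rwa [norm_reflect])⟩

/-! ### Regularity of the difference quotient -/

/-- Differentiation under the integral sign; the derivative of the integrand is bounded on the
compact set `closedBall x 1 × [a, b]`. -/
lemma contDiff_one_intervalIntegral_param {E G : Type*} [NormedAddCommGroup E] [NormedSpace ℝ E]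
    [ProperSpace E] [NormedAddCommGroup G] [NormedSpace ℝ G]
    {f : E → ℝ → G} (a b : ℝ) (hf : ContDiff ℝ 1 (Function.uncurry f)) :
    ContDiff ℝ 1 (fun x => ∫ t in a..b, f x t) := by
  have hfx : ∀ x t, HasFDerivAt (fun y => f y t)
      ((fderiv ℝ (Function.uncurry f) (x, t)).comp (ContinuousLinearMap.inl ℝ E ℝ)) x := by
    intro x t
    have h1 : HasFDerivAt (fun y : E => (y, t)) (ContinuousLinearMap.inl ℝ E ℝ) x :=
      hasFDerivAt_prodMk_left x t
    exact ((hf.differentiable (by simp) (x, t)).hasFDerivAt).comp x h1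
  have hcont : Continuous (fun p : E × ℝ =>
      (fderiv ℝ (Function.uncurry f) p).comp (ContinuousLinearMap.inl ℝ E ℝ)) :=
    (hf.continuous_fderiv (by simp)).clm_comp continuous_const
  have hd : ∀ x, HasFDerivAt (fun x => ∫ t in a..b, f x t)
      (∫ t in a..b, (fderiv ℝ (Function.uncurry f) (x, t)).comp (ContinuousLinearMap.inl ℝ E ℝ))
      x := by
    intro x
    obtain ⟨C, hC⟩ := ((isCompact_closedBall x 1).prod
      (isCompact_uIcc (a := a) (b := b))).exists_bound_of_continuousOn hcont.continuousOn
    have hc : ∀ y, Continuous (f y) := fun y =>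
      hf.continuous.comp (by fun_prop : Continuous fun t : ℝ => (y, t))
    refine intervalIntegral.hasFDerivAt_integral_of_dominated_of_fderiv_le
      (s := Metric.closedBall x 1) (bound := fun _ => C)
      (F' := fun x t => (fderiv ℝ (Function.uncurry f) (x, t)).comp (ContinuousLinearMap.inl ℝ E ℝ))
      (Metric.closedBall_mem_nhds x one_pos) ?_ ?_ ?_ ?_ ?_ ?_
    · exact Eventually.of_forall fun y => (hc y).aestronglyMeasurable
    · exact (hc x).intervalIntegrable _ _
    · exact (hcont.comp (by fun_prop : Continuous fun t : ℝ => (x, t))).aestronglyMeasurable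
    · refine ae_of_all _ fun t ht y hy => hC (y, t) ⟨hy, uIoc_subset_uIcc ht⟩
    · exact intervalIntegrable_const
    · exact ae_of_all _ fun t _ y _ => hfx y t
  rw [contDiff_one_iff_fderiv]
  refine ⟨fun x => (hd x).differentiableAt, ?_⟩
  have : fderiv ℝ (fun x => ∫ t in a..b, f x t) = fun x => ∫ t in a..b,
    (fderiv ℝ (Function.uncurry f) (x, t)).comp (ContinuousLinearMap.inl ℝ E ℝ) :=
    funext fun x => (hd x).fderiv
  rw [this]
  exact intervalIntegral.continuous_parametric_intervalIntegral_of_continuous' (μ := volume)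
    (f := fun x t => (fderiv ℝ (Function.uncurry f) (x, t)).comp (ContinuousLinearMap.inl ℝ E ℝ))
    hcont a b

/-- Hadamard's formula: the segment from `R_i x` (at `t = -1`) to `x` (at `t = 1`) has velocity `x_i
e_i`, so the fundamental theorem of calculus produces the factor `x_i`. On the plane the integrand
is constant, which gives the limit value `2 ∂_i F`. Regularity of the quotient, with the loss of one
derivative, is read off from this. -/
lemma reflQuot_eq_integral (i : Fin 3) {F : E3 → ℂ} (hF : ContDiff ℝ 1 F) (x : E3) :
    reflQuot i F x = ∫ t in (-1 : ℝ)..1,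
      partialDeriv i F (x + ((t - 1) * x i) • EuclideanSpace.single i (1 : ℝ)) := by
  unfold reflQuot
  split_ifs with h
  · simp [h]; norm_num
  · have hd : ∀ t : ℝ, HasDerivAt
        (fun t : ℝ => F (x + ((t - 1) * x i) • EuclideanSpace.single i (1 : ℝ)))
        (partialDeriv i F (x + ((t - 1) * x i) • EuclideanSpace.single i (1 : ℝ)) * (x i : ℂ)) t := by
      intro t
      have h1 : HasDerivAt (fun t : ℝ => x + ((t - 1) * x i) • EuclideanSpace.single i (1 : ℝ))
          (x i • EuclideanSpace.single i (1 : ℝ)) t := by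
        have := ((((hasDerivAt_id t).sub_const 1).mul_const (x i)).smul_const
          (EuclideanSpace.single i (1 : ℝ))).const_add x
        simpa using this
      have h2 := ((hF.differentiable (by simp)
        (x + ((t - 1) * x i) • EuclideanSpace.single i (1 : ℝ))).hasFDerivAt).comp_hasDerivAt t h1
      convert! h2 using 1
      simp [partialDeriv, mul_comm]
    have hc : Continuous fun t : ℝ =>
        partialDeriv i F (x + ((t - 1) * x i) • EuclideanSpace.single i (1 : ℝ)) :=
      (contDiff_partialDeriv i (m := 0) hF (by simp)).continuous.comp (by fun_prop)
    have := intervalIntegral.integral_eq_sub_of_hasDerivAt (a := -1) (b := 1)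
      (fun t _ => hd t) ((hc.mul continuous_const).intervalIntegrable _ _)
    rw [intervalIntegral.integral_mul_const] at this
    have h' : (x i : ℂ) ≠ 0 := by exact_mod_cast h
    rw [div_eq_iff h', this, reflect_eq_add_smul]
    norm_num

lemma continuous_reflQuot (i : Fin 3) {F : E3 → ℂ} (hF : ContDiff ℝ 1 F) :
    Continuous (reflQuot i F) := by
  rw [funext (reflQuot_eq_integral i hF)]
  refine intervalIntegral.continuous_parametric_intervalIntegral_of_continuous' (μ := volume)
    (f := fun x t => partialDeriv i F (x + ((t - 1) * x i) • EuclideanSpace.single i (1 : ℝ)))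
    ?_ _ _
  exact (contDiff_partialDeriv i (m := 0) hF (by simp)).continuous.comp (by fun_prop)

lemma contDiff_reflQuot (i : Fin 3) {F : E3 → ℂ} (hF : ContDiff ℝ 2 F) :
    ContDiff ℝ 1 (reflQuot i F) := by
  rw [funext (reflQuot_eq_integral i (hF.of_le (by norm_num)))]
  refine contDiff_one_intervalIntegral_param
    (f := fun x t => partialDeriv i F (x + ((t - 1) * x i) • EuclideanSpace.single i (1 : ℝ)))
    _ _ ?_
  exact (contDiff_partialDeriv i (m := 1) hF (by norm_num)).comp (by fun_prop)

lemma continuous_dunklD (μ : Fin 3 → ℝ) (i : Fin 3) {F : E3 → ℂ} (hF : ContDiff ℝ 1 F) :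
    Continuous (dunklD μ i F) :=
  (contDiff_partialDeriv i (m := 0) hF (by simp)).continuous.add
    (continuous_const.mul (continuous_reflQuot i hF))

lemma contDiff_dunklD (μ : Fin 3 → ℝ) (i : Fin 3) {F : E3 → ℂ} (hF : ContDiff ℝ 2 F) :
    ContDiff ℝ 1 (dunklD μ i F) :=
  (contDiff_partialDeriv i (m := 1) hF (by norm_num)).add
    (contDiff_const.mul (contDiff_reflQuot i hF))

/-! ### The Dunkl weight -/

/-- The weight `∏ |x_i| ^ (2 μ_i)`. -/
def weight (μ : Fin 3 → ℝ) (x : E3) : ℝ := ∏ i, |x i| ^ (2 * μ i)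

lemma weight_nonneg (μ : Fin 3 → ℝ) (x : E3) : 0 ≤ weight μ x :=
  Finset.prod_nonneg fun _ _ => Real.rpow_nonneg (abs_nonneg _) _

lemma weight_pos (μ : Fin 3 → ℝ) {x : E3} (hx : ∀ i, x i ≠ 0) : 0 < weight μ x :=
  Finset.prod_pos fun i _ => Real.rpow_pos_of_pos (abs_pos.2 (hx i)) _

lemma measurable_weight (μ : Fin 3 → ℝ) : Measurable (weight μ) := by
  unfold weight
  fun_prop

lemma weight_reflect (μ : Fin 3 → ℝ) (i : Fin 3) (x : E3) :
    weight μ (reflect i x) = weight μ x := by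
  unfold weight
  refine Finset.prod_congr rfl fun j _ => ?_
  by_cases hj : j = i
  · subst hj; rw [reflect_same, abs_neg]
  · rw [reflect_ne hj]

lemma integrable_indicator_abs_rpow {m : ℝ} (hm : -(1 / 2 : ℝ) < m) (R : ℝ) :
    Integrable ((Icc (-R) R).indicator fun t : ℝ => |t| ^ (2 * m)) := by
  rw [integrable_indicator_iff measurableSet_Icc]
  rcases lt_or_ge R 0 with hR | hR
  · rw [Icc_eq_empty (by linarith)]; exact integrableOn_empty
  have h1 : IntegrableOn (fun t : ℝ => |t| ^ (2 * m)) (Icc 0 R) := by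
    have := (intervalIntegral.intervalIntegrable_rpow' (a := 0) (b := R)
      (r := 2 * m) (by linarith))
    rw [intervalIntegrable_iff_integrableOn_Icc_of_le hR] at this
    refine this.congr_fun (fun t ht => ?_) measurableSet_Icc
    simp [abs_of_nonneg ht.1]
  have h2 : IntegrableOn (fun t : ℝ => |t| ^ (2 * m)) (Icc (-R) 0) := by
    have := (integrableOn_Icc_iff_integrableOn_Ioc (μ := volume)).1 h1
    have h3 := (MeasurePreserving.integrableOn_comp_preimage
      (Measure.measurePreserving_neg (volume : Measure ℝ))
      (Homeomorph.neg ℝ).measurableEmbedding (f := fun t : ℝ => |t| ^ (2 * m)) (s := Icc 0 R)).2 h1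
    simpa [Function.comp_def] using h3
  have := h2.union h1
  rwa [Icc_union_Icc_eq_Icc (by linarith) hR] at this

/-- The integrand is dominated by a constant times a product of one-variable functions on a cube,
each integrable because its exponent `2 μ_i` exceeds `-1`. -/
lemma integrable_weight_mul {μ : Fin 3 → ℝ} (hμ : ∀ i, -(1 / 2 : ℝ) < μ i) {F : E3 → ℂ}
    (hF : Continuous F) (hb : BddSupp F) :
    Integrable fun x => (weight μ x : ℂ) * F x := by
  obtain ⟨R, hR⟩ := hb
  obtain ⟨C, hC⟩ := (isCompact_closedBall (0 : E3) R).exists_bound_of_continuousOn hF.continuousOn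
  have h1 : Integrable fun y : Fin 3 → ℝ =>
      ∏ i, (Icc (-R) R).indicator (fun t : ℝ => |t| ^ (2 * μ i)) (y i) :=
    Integrable.fintype_prod fun i => integrable_indicator_abs_rpow (hμ i) R
  have h2 := ((PiLp.volume_preserving_ofLp (Fin 3)).integrable_comp_emb
    (MeasurableEquiv.toLp 2 (Fin 3 → ℝ)).symm.measurableEmbedding).2 h1
  refine (h2.const_mul |C|).mono'
    ((Complex.measurable_ofReal.comp (measurable_weight μ)).aestronglyMeasurable.mul
      hF.aestronglyMeasurable) (ae_of_all _ fun x => ?_)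
  have h0 : ∀ i, 0 ≤ (Icc (-R) R).indicator (fun t : ℝ => |t| ^ (2 * μ i)) (x i) :=
    fun i => indicator_nonneg (fun t _ => Real.rpow_nonneg (abs_nonneg t) _) _
  simp only [norm_mul, Complex.norm_real, Function.comp_apply]
  by_cases hx : ‖x‖ ≤ R
  · have hi : ∀ i, (Icc (-R) R).indicator (fun t : ℝ => |t| ^ (2 * μ i)) (x i)
        = |x i| ^ (2 * μ i) := fun i => by
      refine indicator_of_mem ?_ _
      exact abs_le.1 ((PiLp.norm_apply_le x i).trans hx)
    rw [Real.norm_of_nonneg (weight_nonneg μ x), mul_comm]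
    simp only [hi]
    exact mul_le_mul ((hC x (by simpa using hx)).trans (le_abs_self C)) le_rfl
      (weight_nonneg μ x) (abs_nonneg C)
  · rw [hR x (not_le.1 hx)]
    simp only [norm_zero, mul_zero]
    exact mul_nonneg (abs_nonneg C) (Finset.prod_nonneg fun i _ => h0 i)

/-- The integral against the Dunkl weight. -/
def wint (μ : Fin 3 → ℝ) (F : E3 → ℂ) : ℂ := ∫ x, (weight μ x : ℂ) * F x

lemma wint_add {μ : Fin 3 → ℝ} (hμ : ∀ i, -(1 / 2 : ℝ) < μ i) {F G : E3 → ℂ}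
    (hF : Continuous F) (hFb : BddSupp F) (hG : Continuous G) (hGb : BddSupp G) :
    wint μ (fun x => F x + G x) = wint μ F + wint μ G := by
  unfold wint
  rw [← integral_add (integrable_weight_mul hμ hF hFb) (integrable_weight_mul hμ hG hGb)]
  simp only [mul_add]

lemma wint_const_mul (μ : Fin 3 → ℝ) (c : ℂ) (F : E3 → ℂ) :
    wint μ (fun x => c * F x) = c * wint μ F := by
  unfold wint
  rw [← integral_const_mul]
  congr 1; ext x; ring

lemma wint_sum {μ : Fin 3 → ℝ} (hμ : ∀ i, -(1 / 2 : ℝ) < μ i) {ι : Type*} (s : Finset ι)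
    {F : ι → E3 → ℂ} (hF : ∀ i, Continuous (F i)) (hb : ∀ i, BddSupp (F i)) :
    wint μ (fun x => ∑ i ∈ s, F i x) = ∑ i ∈ s, wint μ (F i) := by
  unfold wint
  rw [← integral_finsetSum s fun i _ => integrable_weight_mul hμ (hF i) (hb i)]
  simp only [Finset.mul_sum]

lemma wint_comp_reflect (μ : Fin 3 → ℝ) (i : Fin 3) (F : E3 → ℂ) :
    wint μ (fun x => F (reflect i x)) = wint μ F := by
  unfold wint
  have h := (reflectLI i).measurePreserving.integral_comp
    (reflectLI i).toHomeomorph.measurableEmbedding (fun x => (weight μ x : ℂ) * F x)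
  rw [← h]
  simp only [reflectLI_apply, weight_reflect]

lemma wint_eq_zero_of_odd {μ : Fin 3 → ℝ} {i : Fin 3} {F : E3 → ℂ}
    (h : ∀ x, F (reflect i x) = - F x) : wint μ F = 0 := by
  have h1 := wint_comp_reflect μ i F
  have h2 : wint μ (fun x => F (reflect i x)) = - wint μ F := by
    have := wint_const_mul μ (-1) F
    simp only [h]
    simpa using this
  rw [h1] at h2
  exact self_eq_neg.1 h2

/-! ### The Dunkl operator has vanishing integral -/

/-- Folded onto the positive half-line, the integrand is the derivative of `x^(2m) (h x - h (-x))`.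
This function equals `x^(2m+1) q x`, so it tends to `0` at the origin since `2m + 1 > 0`, and it
vanishes for large `x`. -/
lemma integral_abs_rpow_mul_dunkl_eq_zero {m : ℝ} (hm : -(1 / 2 : ℝ) < m) {h h' q : ℝ → ℂ}
    (hd : ∀ x, HasDerivAt h (h' x) x) (hc : Continuous h') (hqc : Continuous q)
    (hq : ∀ x : ℝ, q x * x = h x - h (-x)) {R : ℝ} (hR : ∀ x, R < |x| → h' x = 0 ∧ q x = 0) :
    ∫ x : ℝ, ((|x| ^ (2 * m) : ℝ) : ℂ) * (h' x + m * q x) = 0 := by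
  set f : ℝ → ℂ := fun x => ((|x| ^ (2 * m) : ℝ) : ℂ) * (h' x + m * q x) with hf
  have hfc : Continuous fun x => h' x + m * q x := hc.add (continuous_const.mul hqc)
  obtain ⟨C, hC⟩ := (isCompact_Icc (a := -R) (b := R)).exists_bound_of_continuousOn
    hfc.continuousOn
  have hfi : Integrable f := by
    refine ((integrable_indicator_abs_rpow hm R).mul_const |C|).mono' ?_ (ae_of_all _ fun x => ?_)
    · have : Measurable fun x : ℝ => ((|x| ^ (2 * m) : ℝ) : ℂ) := by fun_prop
      exact this.aestronglyMeasurable.mul hfc.aestronglyMeasurable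
    · by_cases hx : |x| ≤ R
      · have hx' : x ∈ Icc (-R) R := abs_le.1 hx
        rw [indicator_of_mem hx', hf, norm_mul, Complex.norm_real,
          Real.norm_of_nonneg (Real.rpow_nonneg (abs_nonneg x) _)]
        exact mul_le_mul_of_nonneg_left ((hC x hx').trans (le_abs_self C))
          (Real.rpow_nonneg (abs_nonneg x) _)
      · obtain ⟨h1, h2⟩ := hR x (not_le.1 hx)
        simp only [hf, h1, h2, mul_zero, add_zero, norm_zero]
        exact mul_nonneg (indicator_nonneg (fun t _ => Real.rpow_nonneg (abs_nonneg t) _) _)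
          (abs_nonneg C)
  have hsplit : ∫ x, f x = ∫ x in Ioi (0 : ℝ), (f x + f (-x)) := by
    rw [integral_add hfi.integrableOn hfi.comp_neg.integrableOn, integral_comp_neg_Ioi, neg_zero,
      add_comm, ← intervalIntegral.integral_Iic_add_Ioi hfi.integrableOn hfi.integrableOn]
  rw [hsplit]
  have hqe : ∀ x : ℝ, x ≠ 0 → q (-x) = q x := by
    intro x hx
    have h1 := hq x
    have h2 := hq (-x)
    have hx' : (x : ℂ) ≠ 0 := by exact_mod_cast hx
    apply mul_right_cancel₀ hx'
    rw [neg_neg] at h2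
    push_cast at h2
    linear_combination -h2 - h1
  have hderiv : ∀ x ∈ Ioi (0 : ℝ),
      HasDerivAt (fun x : ℝ => ((x ^ (2 * m) : ℝ) : ℂ) * (h x - h (-x))) (f x + f (-x)) x := by
    intro x hx
    have hx0 : (0 : ℝ) < x := hx
    have h1 : HasDerivAt (fun x : ℝ => ((x ^ (2 * m) : ℝ) : ℂ))
        ((2 * m * x ^ (2 * m - 1) : ℝ) : ℂ) x :=
      (Real.hasDerivAt_rpow_const (Or.inl hx0.ne')).ofReal_comp
    have h2 : HasDerivAt (fun x : ℝ => h (-x)) (- h' (-x)) x := by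
      have := (hd (-x)).scomp x (hasDerivAt_neg x)
      simpa [Function.comp_def] using this
    have h3 := h1.mul ((hd x).sub h2)
    convert! h3 using 1
    simp only [hf, abs_neg, abs_of_pos hx0, hqe x hx0.ne']
    rw [Pi.sub_apply, ← hq x, Real.rpow_sub_one hx0.ne']
    have hx' : (x : ℂ) ≠ 0 := by exact_mod_cast hx0.ne'
    push_cast
    field_simp
    ring
  -- For `m < 0` the factor `x^(2m)` is unbounded near `0`; continuity comes from rewriting the
  -- product as `x^(2m+1) q x`.
  have hcont : ContinuousWithinAt (fun x : ℝ => ((x ^ (2 * m) : ℝ) : ℂ) * (h x - h (-x)))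
      (Ici 0) 0 := by
    have h1 : ContinuousWithinAt (fun x : ℝ => ((x ^ (2 * m + 1) : ℝ) : ℂ) * q x) (Ici 0) 0 := by
      apply Continuous.continuousWithinAt
      exact (Complex.continuous_ofReal.comp
        (Real.continuous_rpow_const (by linarith))).mul hqc
    refine h1.congr_of_mem (fun x hx => ?_) (by simp)
    rcases (show (0 : ℝ) ≤ x from hx).eq_or_lt with rfl | hx0
    · rw [Real.zero_rpow (by linarith : 2 * m + 1 ≠ 0)]; simp
    · rw [← hq x, Real.rpow_add_one hx0.ne']; push_cast; ring
  have hlim : Tendsto (fun x : ℝ => ((x ^ (2 * m) : ℝ) : ℂ) * (h x - h (-x))) atTop (𝓝 0) := by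
    refine tendsto_const_nhds.congr' ?_
    filter_upwards [Ioi_mem_atTop R, Ioi_mem_atTop 0] with x hx hx0
    rw [← hq x, (hR x (by rw [abs_of_pos hx0]; exact hx)).2]; simp
  rw [integral_Ioi_of_hasDerivAt_of_tendsto hcont hderiv
    (hfi.integrableOn.add hfi.comp_neg.integrableOn) hlim]
  simp

/-- Splitting off the `i`-th coordinate. -/
def splitCoord (i : Fin 3) : ℝ × (Fin 2 → ℝ) ≃ᵐ E3 :=
  (MeasurableEquiv.piFinSuccAbove (fun _ => ℝ) i).symm.trans (MeasurableEquiv.toLp 2 (Fin 3 → ℝ))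

lemma measurePreserving_splitCoord (i : Fin 3) : MeasurePreserving (splitCoord i) :=
  (PiLp.volume_preserving_toLp (Fin 3)).comp
    ((volume_preserving_piFinSuccAbove (fun _ : Fin 3 => ℝ) i).symm _)

lemma splitCoord_same (i : Fin 3) (t : ℝ) (y : Fin 2 → ℝ) : splitCoord i (t, y) i = t := by
  change Fin.insertNth (α := fun _ => ℝ) i t y i = t
  simp

lemma splitCoord_succAbove (i : Fin 3) (t : ℝ) (y : Fin 2 → ℝ) (j : Fin 2) :
    splitCoord i (t, y) (i.succAbove j) = y j := by
  change Fin.insertNth (α := fun _ => ℝ) i t y (i.succAbove j) = y j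
  simp

lemma splitCoord_eq (i : Fin 3) (t : ℝ) (y : Fin 2 → ℝ) :
    splitCoord i (t, y) = splitCoord i (0, y) + t • EuclideanSpace.single i (1 : ℝ) := by
  ext j
  rcases Fin.eq_self_or_eq_succAbove i j with rfl | ⟨k, rfl⟩
  · simp [splitCoord_same]
  · simp [splitCoord_succAbove]

lemma reflect_splitCoord (i : Fin 3) (t : ℝ) (y : Fin 2 → ℝ) :
    reflect i (splitCoord i (t, y)) = splitCoord i (-t, y) := by
  ext j
  rcases Fin.eq_self_or_eq_succAbove i j with rfl | ⟨k, rfl⟩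
  · simp [splitCoord_same, reflect_same]
  · rw [reflect_ne (Fin.succAbove_ne i k)]
    simp [splitCoord_succAbove]

lemma weight_splitCoord (μ : Fin 3 → ℝ) (i : Fin 3) (t : ℝ) (y : Fin 2 → ℝ) :
    weight μ (splitCoord i (t, y))
      = |t| ^ (2 * μ i) * ∏ j, |y j| ^ (2 * μ (i.succAbove j)) := by
  unfold weight
  rw [Fin.prod_univ_succAbove _ i]
  simp only [splitCoord_same, splitCoord_succAbove]

lemma reflQuot_mul_coord (i : Fin 3) (F : E3 → ℂ) (x : E3) :
    reflQuot i F x * (x i : ℂ) = F x - F (reflect i x) := by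
  unfold reflQuot
  split_ifs with h
  · rw [reflect_of_eq_zero h, h]; simp
  · exact div_mul_cancel₀ _ (by exact_mod_cast h)

/-- By Fubini, the inner integral along the `i`-th axis already vanishes by the one-variable case;
the other factors of the weight are constant on each line. -/
theorem wint_dunklD_eq_zero {μ : Fin 3 → ℝ} (hμ : ∀ i, -(1 / 2 : ℝ) < μ i) (i : Fin 3)
    {H : E3 → ℂ} (hH : ContDiff ℝ 1 H) (hb : BddSupp H) : wint μ (dunklD μ i H) = 0 := by
  have hint := integrable_weight_mul hμ (continuous_dunklD μ i hH) (hb.dunklD μ i)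
  unfold wint
  rw [← (measurePreserving_splitCoord i).integral_comp (splitCoord i).measurableEmbedding]
  have hint' := ((measurePreserving_splitCoord i).integrable_comp_emb
    (splitCoord i).measurableEmbedding).2 hint
  rw [Measure.volume_eq_prod] at hint' ⊢
  simp only [Function.comp_def] at hint'
  rw [integral_prod_symm _ hint']
  refine integral_eq_zero_of_ae (ae_of_all _ fun y => ?_)
  simp only [weight_splitCoord, Pi.zero_apply]
  have hcs : Continuous fun t : ℝ => splitCoord i (t, y) := by
    rw [funext fun t => splitCoord_eq i t y]; fun_prop
  obtain ⟨R, hR⟩ := hb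
  have hlarge : ∀ t : ℝ, R < |t| → R < ‖splitCoord i (t, y)‖ := fun t ht => by
    refine ht.trans_le ?_
    have := PiLp.norm_apply_le (splitCoord i (t, y)) i
    rwa [splitCoord_same] at this
  have key := integral_abs_rpow_mul_dunkl_eq_zero (hμ i)
    (h := fun t => H (splitCoord i (t, y))) (h' := fun t => partialDeriv i H (splitCoord i (t, y)))
    (q := fun t => reflQuot i H (splitCoord i (t, y))) (R := R) ?_ ?_ ?_ ?_ ?_
  · calc _ = ∫ t : ℝ, ((∏ j, |y j| ^ (2 * μ (i.succAbove j)) : ℝ) : ℂ) *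
          (((|t| ^ (2 * μ i) : ℝ) : ℂ) * (partialDeriv i H (splitCoord i (t, y))
            + μ i * reflQuot i H (splitCoord i (t, y)))) := by
          congr 1; ext t; unfold dunklD; push_cast; ring
      _ = 0 := by rw [integral_const_mul, key, mul_zero]
  · intro t
    have h1 : HasDerivAt (fun t : ℝ => splitCoord i (t, y)) (EuclideanSpace.single i (1 : ℝ)) t := by
      rw [funext fun t => splitCoord_eq i t y]
      have := ((hasDerivAt_id t).smul_const (EuclideanSpace.single i (1 : ℝ))).const_add
        (splitCoord i (0, y))
      simpa using this
    exact ((hH.differentiable (by simp) _).hasFDerivAt).comp_hasDerivAt t h1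
  · exact (contDiff_partialDeriv i (m := 0) hH (by simp)).continuous.comp hcs
  · exact (continuous_reflQuot i hH).comp hcs
  · intro t
    have := reflQuot_mul_coord i H (splitCoord i (t, y))
    rwa [splitCoord_same, reflect_splitCoord] at this
  · intro t ht
    have h0 : H =ᶠ[𝓝 (splitCoord i (t, y))] fun _ => 0 := by
      filter_upwards [(isOpen_Ioi.preimage continuous_norm).mem_nhds (hlarge t ht)] with z hz
        using hR z hz
    have hp : partialDeriv i H (splitCoord i (t, y)) = 0 := by
      rw [partialDeriv_congr i h0, partialDeriv_const]
    refine ⟨hp, ?_⟩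
    simp only [reflQuot, hp, reflect_splitCoord]
    rw [hR _ (hlarge t ht), hR _ (hlarge (-t) (by rwa [abs_neg]))]
    simp

/-- The Leibniz rule fails only by a term odd under `R_i`, which integrates to zero against the
invariant weight. Hence the integral of `D_i (u v)`, which vanishes, equals that of `D_i u · v + u ·
D_i v`. -/
theorem wint_dunklD_mul {μ : Fin 3 → ℝ} (hμ : ∀ i, -(1 / 2 : ℝ) < μ i) (i : Fin 3)
    {u v : E3 → ℂ} (hu : ContDiff ℝ 1 u) (hub : BddSupp u) (hv : ContDiff ℝ 1 v) :
    wint μ (fun x => dunklD μ i u x * v x) = - wint μ (fun x => u x * dunklD μ i v x) := by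
  have h1 := wint_dunklD_eq_zero hμ i (hu.mul hv) (hub.mul_right v)
  -- The Leibniz defect `μ_i (u - R_i u)(v - R_i v) / x_i`, written with difference quotients so
  -- that it is visibly continuous.
  set Q : E3 → ℂ := fun x => μ i * (x i : ℂ) * (reflQuot i u x * reflQuot i v x) with hQ
  have hQc : Continuous Q := by
    have := continuous_reflQuot i hu
    have := continuous_reflQuot i hv
    have := (contDiff_coordC i (n := 0)).continuous
    fun_prop
  have hpt : ∀ x, dunklD μ i u x * v x + u x * dunklD μ i v x
      = dunklD μ i (fun y => u y * v y) x + Q x := by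
    intro x
    have e1 := partialDeriv_mul i (hu.differentiable (by simp) x) (hv.differentiable (by simp) x)
    by_cases hx : x i = 0
    · simp only [dunklD, hQ, reflQuot, hx, if_true, e1]; simp; ring
    · have hx' : (x i : ℂ) ≠ 0 := by exact_mod_cast hx
      simp only [dunklD, hQ, reflQuot, hx, if_false, e1]
      field_simp
      ring
  have hodd : ∀ x, Q (reflect i x) = - Q x := by
    have hr : ∀ (F : E3 → ℂ) (x : E3), x i ≠ 0 →
        reflQuot i F (reflect i x) = reflQuot i F x := by
      intro F x hx
      have hx' : (x i : ℂ) ≠ 0 := by exact_mod_cast hx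
      simp only [reflQuot, reflect_same, neg_eq_zero, hx, if_false, reflect_reflect]
      push_cast
      field_simp
      ring
    intro x
    by_cases hx : x i = 0
    · simp only [hQ, reflect_same, hx]; simp
    · simp only [hQ, hr _ x hx, reflect_same]; push_cast; ring
  have hub' := hub.dunklD μ i
  have hDu := continuous_dunklD μ i hu
  have hDv := continuous_dunklD μ i hv
  have hQb : BddSupp Q := by
    obtain ⟨R, hR⟩ := hub
    refine ⟨R, fun x hx => ?_⟩
    have : Q x = μ i * (reflQuot i u x * (x i : ℂ)) * reflQuot i v x := by simp only [hQ]; ring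
    rw [this, reflQuot_mul_coord, hR x hx, hR _ (by rwa [norm_reflect])]
    simp
  have h2 : wint μ (fun x => dunklD μ i u x * v x) + wint μ (fun x => u x * dunklD μ i v x) = 0 := by
    have h3 := wint_add hμ (hDu.fun_mul hv.continuous) (hub'.mul_right v)
      (hu.continuous.fun_mul hDv) (hub.mul_right _)
    rw [← h3]
    simp only [hpt]
    rw [wint_add hμ (continuous_dunklD μ i (hu.mul hv)) ((hub.mul_right v).dunklD μ i) hQc hQb,
      h1, wint_eq_zero_of_odd hodd, add_zero]
  exact eq_neg_of_add_eq_zero_left h2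

theorem wint_dunklLaplacian_mul {μ : Fin 3 → ℝ} (hμ : ∀ i, -(1 / 2 : ℝ) < μ i)
    {u v : E3 → ℂ} (hu : ContDiff ℝ 2 u) (hub : BddSupp u) (hv : ContDiff ℝ 2 v) :
    wint μ (fun x => dunklLaplacian μ u x * v x)
      = wint μ (fun x => u x * dunklLaplacian μ v x) := by
  have hu1 : ContDiff ℝ 1 u := hu.of_le (by norm_num)
  have hv1 : ContDiff ℝ 1 v := hv.of_le (by norm_num)
  simp only [dunklLaplacian, Finset.sum_mul, Finset.mul_sum]
  rw [wint_sum hμ, wint_sum hμ]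
  · refine Finset.sum_congr rfl fun i _ => ?_
    rw [wint_dunklD_mul hμ i (contDiff_dunklD μ i hu) (hub.dunklD μ i) hv1,
      wint_dunklD_mul hμ i hu1 hub (contDiff_dunklD μ i hv), neg_neg]
  · exact fun i => hu.continuous.mul (continuous_dunklD μ i (contDiff_dunklD μ i hv))
  · exact fun i => hub.mul_right _
  · exact fun i => (continuous_dunklD μ i (contDiff_dunklD μ i hu)).mul hv.continuous
  · exact fun i => ((hub.dunklD μ i).dunklD μ i).mul_right _

/-! ### Product rules -/

lemma partialDeriv_const_mul (i : Fin 3) (c : ℂ) (F : E3 → ℂ) (x : E3) :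
    partialDeriv i (fun y => c * F y) x = c * partialDeriv i F x := by
  unfold partialDeriv
  change fderiv ℝ (c • F) x _ = _
  rw [fderiv_const_smul_field]; rfl

lemma dunklD_add (μ : Fin 3 → ℝ) (i : Fin 3) {F G : E3 → ℂ} {x : E3}
    (hF : DifferentiableAt ℝ F x) (hG : DifferentiableAt ℝ G x) :
    dunklD μ i (fun y => F y + G y) x = dunklD μ i F x + dunklD μ i G x := by
  unfold dunklD reflQuot
  rw [partialDeriv_add i hF hG]
  split_ifs <;> ring

lemma dunklD_const_mul (μ : Fin 3 → ℝ) (i : Fin 3) (c : ℂ) (F : E3 → ℂ) (x : E3) :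
    dunklD μ i (fun y => c * F y) x = c * dunklD μ i F x := by
  unfold dunklD reflQuot
  rw [partialDeriv_const_mul i c F]
  split_ifs <;> ring

lemma dunklD_sum (μ : Fin 3 → ℝ) (i : Fin 3) {ι : Type*} (s : Finset ι) {F : ι → E3 → ℂ} {x : E3}
    (hF : ∀ k, DifferentiableAt ℝ (F k) x) :
    dunklD μ i (fun y => ∑ k ∈ s, F k y) x = ∑ k ∈ s, dunklD μ i (F k) x := by
  classical
  induction s using Finset.induction_on with
  | empty => simpa using dunklD_zero μ i x
  | insert k s hk ih =>
    simp only [Finset.sum_insert hk]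
    rw [dunklD_add μ i (hF k) (by fun_prop), ih]

lemma dunklD_mul_of_invariant (μ : Fin 3 → ℝ) (i : Fin 3) {q F : E3 → ℂ} {x : E3}
    (hq : DifferentiableAt ℝ q x) (hF : DifferentiableAt ℝ F x)
    (hinv : q (reflect i x) = q x) (h0 : x i = 0 → partialDeriv i q x = 0) :
    dunklD μ i (fun y => q y * F y) x = q x * dunklD μ i F x + partialDeriv i q x * F x := by
  unfold dunklD reflQuot
  rw [partialDeriv_mul i hq hF]
  beta_reduce
  rw [hinv]
  split_ifs with h
  · rw [h0 h]; ring
  · ring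

lemma dunklD_coord_mul (μ : Fin 3 → ℝ) (i : Fin 3) {q : E3 → ℂ} {x : E3}
    (hq : DifferentiableAt ℝ q x) :
    dunklD μ i (fun y => (y i : ℂ) * q y) x
      = q x + x i * partialDeriv i q x + μ i * (q x + q (reflect i x)) := by
  unfold dunklD reflQuot
  rw [partialDeriv_mul i ((contDiff_coordC i (n := 1)).differentiable (by simp) x) hq,
    partialDeriv_coord, if_pos rfl]
  beta_reduce
  rw [reflect_same]
  split_ifs with h
  · rw [reflect_of_eq_zero h, h, Complex.ofReal_zero]; ring
  · have h' : (x i : ℂ) ≠ 0 := Complex.ofReal_ne_zero.2 h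
    push_cast
    field_simp
    ring

lemma coord_mul_dunklD (μ : Fin 3 → ℝ) (i : Fin 3) (F : E3 → ℂ) (x : E3) :
    (x i : ℂ) * dunklD μ i F x = x i * partialDeriv i F x + μ i * (F x - F (reflect i x)) := by
  rw [← reflQuot_mul_coord]; unfold dunklD; ring

lemma hasFDerivAt_radial {η : ℝ → ℂ} {η' : ℂ} {x : E3} (h : HasDerivAt η η' (‖x‖ ^ 2)) :
    HasFDerivAt (fun y : E3 => η (‖y‖ ^ 2))
      ((2 • innerSL ℝ x).smulRight η') x := by
  have := HasFDerivAt.comp (f := fun y : E3 => ‖y‖ ^ 2) x h.hasFDerivAt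
    (hasStrictFDerivAt_norm_sq x).hasFDerivAt
  convert! this using 1

lemma partialDeriv_radial (i : Fin 3) {η : ℝ → ℂ} {η' : ℂ} {x : E3}
    (h : HasDerivAt η η' (‖x‖ ^ 2)) :
    partialDeriv i (fun y : E3 => η (‖y‖ ^ 2)) x = 2 * x i * η' := by
  unfold partialDeriv
  rw [(hasFDerivAt_radial h).fderiv]
  simp [EuclideanSpace.inner_single_right]

lemma fderiv_radial_self {η : ℝ → ℂ} {η' : ℂ} {x : E3} (h : HasDerivAt η η' (‖x‖ ^ 2)) :
    fderiv ℝ (fun y : E3 => η (‖y‖ ^ 2)) x x = 2 * ((‖x‖ ^ 2 : ℝ) : ℂ) * η' := by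
  rw [(hasFDerivAt_radial h).fderiv]
  simp

lemma dunklD_radial_mul (μ : Fin 3 → ℝ) (i : Fin 3) {η : ℝ → ℂ} {η' : ℂ} {F : E3 → ℂ} {x : E3}
    (h : HasDerivAt η η' (‖x‖ ^ 2)) (hF : DifferentiableAt ℝ F x) :
    dunklD μ i (fun y => η (‖y‖ ^ 2) * F y) x
      = η (‖x‖ ^ 2) * dunklD μ i F x + 2 * x i * η' * F x := by
  rw [dunklD_mul_of_invariant μ i (hasFDerivAt_radial h).differentiableAt hF
    (by rw [norm_reflect]) (fun h0 => by rw [partialDeriv_radial i h, h0]; simp),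
    partialDeriv_radial i h]

lemma norm_sq_eq_sum (x : E3) : ((‖x‖ ^ 2 : ℝ) : ℂ) = ∑ i, (x i : ℂ) ^ 2 := by
  rw [EuclideanSpace.norm_sq_eq]; push_cast
  refine Finset.sum_congr rfl fun i _ => ?_
  rw [Real.norm_eq_abs]; norm_cast; exact sq_abs _

/-- Radial factors are reflection invariant, so `D_i (η p) = η D_i p + 2 x_i η' p`. In the second
application the reflected values of `p` cancel between `x_i D_i p` and `D_i (x_i η' p)`; only the
Euler operator, of eigenvalue `N`, remains after summation. -/
theorem dunklLaplacian_radial_mul (μ : Fin 3 → ℝ) {η η' η'' : ℝ → ℂ} {s : Set ℝ} (hs : IsOpen s)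
    (h1 : ∀ t ∈ s, HasDerivAt η (η' t) t) (h2 : ∀ t ∈ s, HasDerivAt η' (η'' t) t)
    {p : E3 → ℂ} (hp : ContDiff ℝ 2 p) {N : ℂ} {x : E3} (hx : ‖x‖ ^ 2 ∈ s)
    (hN : fderiv ℝ p x x = N * p x) :
    dunklLaplacian μ (fun y => η (‖y‖ ^ 2) * p y) x
      = η (‖x‖ ^ 2) * dunklLaplacian μ p x
        + (4 * ((‖x‖ ^ 2 : ℝ) : ℂ) * η'' (‖x‖ ^ 2)
          + 2 * (2 * N + 3 + 2 * ∑ i, (μ i : ℂ)) * η' (‖x‖ ^ 2)) * p x := by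
  have hpd : Differentiable ℝ p := hp.differentiable (by simp)
  have hterm : ∀ i, dunklD μ i (dunklD μ i (fun y => η (‖y‖ ^ 2) * p y)) x
      = η (‖x‖ ^ 2) * dunklD μ i (dunklD μ i p) x + 4 * η' (‖x‖ ^ 2) * (x i * partialDeriv i p x)
        + (2 + 4 * μ i) * (η' (‖x‖ ^ 2) * p x) + (x i : ℂ) ^ 2 * (4 * η'' (‖x‖ ^ 2) * p x) := by
    intro i
    have hDp : Differentiable ℝ (dunklD μ i p) := (contDiff_dunklD μ i hp).differentiable (by simp)
    have hq : DifferentiableAt ℝ (fun y => 2 * (η' (‖y‖ ^ 2) * p y)) x :=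
      ((hasFDerivAt_radial (h2 _ hx)).differentiableAt.fun_mul (hpd x)).const_mul 2
    rw [dunklD_congr μ i (s := (fun r => r ^ 2) ⁻¹' s)
      (G := fun y => η (‖y‖ ^ 2) * dunklD μ i p y + (y i : ℂ) * (2 * (η' (‖y‖ ^ 2) * p y)))
      (hs.preimage (by fun_prop)) (fun y hy => ?_) hx]
    · rw [dunklD_add μ i
        ((hasFDerivAt_radial (h1 _ hx)).differentiableAt.fun_mul (hDp x))
        (((contDiff_coordC i (n := 1)).differentiable (by simp) x).fun_mul hq),
        dunklD_radial_mul μ i (h1 _ hx) (hDp x), dunklD_coord_mul μ i hq,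
        partialDeriv_const_mul i 2,
        partialDeriv_mul i (hasFDerivAt_radial (h2 _ hx)).differentiableAt (hpd x),
        partialDeriv_radial i (h2 _ hx), norm_reflect]
      have := coord_mul_dunklD μ i p x
      linear_combination (2 * η' (‖x‖ ^ 2)) * this
    · rw [dunklD_radial_mul μ i (h1 _ hy) (hpd y)]; ring
  unfold dunklLaplacian
  rw [Finset.sum_congr rfl fun i _ => hterm i]
  simp only [Finset.sum_add_distrib, ← Finset.mul_sum, ← Finset.sum_mul]
  rw [← fderiv_self_eq_sum, hN, ← norm_sq_eq_sum]
  simp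
  ring

/-! ### The Euler operator -/

/-- Integrate `D_i (x_i H) = x_i ∂_i H + (1 + μ_i) H + μ_i R_i H`, whose integral is zero, use
invariance under `R_i`, and sum over `i`. -/
theorem wint_fderiv_self {μ : Fin 3 → ℝ} (hμ : ∀ i, -(1 / 2 : ℝ) < μ i) {H : E3 → ℂ}
    (hH : ContDiff ℝ 1 H) (hb : BddSupp H) :
    wint μ (fun x => fderiv ℝ H x x) = -(3 + 2 * ∑ i, (μ i : ℂ)) * wint μ H := by
  have hpc : ∀ i, Continuous fun x : E3 => (x i : ℂ) * partialDeriv i H x := fun i =>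
    (contDiff_coordC i (n := 0)).continuous.mul
      (contDiff_partialDeriv i (m := 0) hH (by simp)).continuous
  have hpb : ∀ i, BddSupp fun x : E3 => (x i : ℂ) * partialDeriv i H x := by
    intro i
    obtain ⟨R, hR⟩ := hb
    refine ⟨R, fun x hx => ?_⟩
    beta_reduce
    rw [partialDeriv_congr i (G := fun _ => 0), partialDeriv_const, mul_zero]
    filter_upwards [(isOpen_Ioi.preimage continuous_norm).mem_nhds hx] with z hz using hR z hz
  have h1 : ∀ i, wint μ (fun x => (x i : ℂ) * partialDeriv i H x) = -(1 + 2 * μ i) * wint μ H := by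
    intro i
    have h := wint_dunklD_eq_zero hμ i ((contDiff_coordC i).mul hH) (hb.mul_left fun x => (x i : ℂ))
    have he : dunklD μ i (fun y => (y i : ℂ) * H y) = fun x =>
        ((x i : ℂ) * partialDeriv i H x + (1 + μ i) * H x) + μ i * H (reflect i x) := by
      ext x
      rw [dunklD_coord_mul μ i (hH.differentiable (by simp) x)]; ring
    have hHc := hH.continuous
    have hrc : Continuous fun x => H (reflect i x) := hHc.comp (continuous_reflect i)
    rw [he, wint_add hμ ((hpc i).fun_add (continuous_const.fun_mul hHc))
      ((hpb i).add (hb.mul_left _)) (continuous_const.fun_mul hrc) ((hb.comp_reflect i).mul_left _),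
      wint_add hμ (hpc i) (hpb i) (continuous_const.fun_mul hHc) (hb.mul_left _),
      wint_const_mul, wint_const_mul, wint_comp_reflect] at h
    linear_combination h
  simp only [fderiv_self_eq_sum]
  rw [wint_sum hμ _ hpc hpb, Finset.sum_congr rfl fun i _ => h1 i]
  simp only [Fin.sum_univ_three]
  ring

/-! ### Monomials -/

/-- The monomial `∏ x_i ^ (a_i)`. -/
def mono (a : Fin 3 → ℕ) (x : E3) : ℂ := ∏ i, (x i : ℂ) ^ a i

/-- The monomial `∏ x_j ^ (a_j)` without its `i`-th factor. -/
def monoErase (i : Fin 3) (a : Fin 3 → ℕ) (x : E3) : ℂ :=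
  ∏ j ∈ Finset.univ.erase i, (x j : ℂ) ^ a j

lemma contDiff_mono (a : Fin 3 → ℕ) {n : WithTop ℕ∞} : ContDiff ℝ n (mono a) := by
  unfold mono
  exact contDiff_prod fun i _ => (contDiff_coordC i).pow _

lemma contDiff_monoErase (i : Fin 3) (a : Fin 3 → ℕ) {n : WithTop ℕ∞} :
    ContDiff ℝ n (monoErase i a) := by
  unfold monoErase
  exact contDiff_prod fun i _ => (contDiff_coordC i).pow _

lemma mono_eq (i : Fin 3) (a : Fin 3 → ℕ) (x : E3) :
    mono a x = monoErase i a x * (x i : ℂ) ^ a i :=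
  (Finset.prod_erase_mul _ _ (Finset.mem_univ i)).symm

lemma mono_update (i : Fin 3) (a : Fin 3 → ℕ) (b : ℕ) (x : E3) :
    mono (Function.update a i b) x = monoErase i a x * (x i : ℂ) ^ b := by
  rw [mono_eq i]
  congr 1
  · refine Finset.prod_congr rfl fun j hj => ?_
    rw [Function.update_of_ne (Finset.ne_of_mem_erase hj)]
  · simp

/-- The coefficient in `D x ^ k = dunklCoeff m k * x ^ (k - 1)`. -/
def dunklCoeff (m : ℝ) (k : ℕ) : ℂ := k + m * (1 - (-1) ^ k)

lemma dunklCoeff_zero (m : ℝ) : dunklCoeff m 0 = 0 := by simp [dunklCoeff]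

lemma dunklD_coord_pow (μ : Fin 3 → ℝ) (i : Fin 3) (k : ℕ) (x : E3) :
    dunklD μ i (fun y => (y i : ℂ) ^ k) x = dunklCoeff (μ i) k * (x i : ℂ) ^ (k - 1) := by
  have hp : partialDeriv i (fun y => (y i : ℂ) ^ k) x = k * (x i : ℂ) ^ (k - 1) := by
    have h := ((contDiff_coordC i (n := 1)).differentiable (by simp) x).hasFDerivAt
    have h' := partialDeriv_coord i i x
    unfold partialDeriv at h' ⊢
    rw [HasFDerivAt.fderiv (h.pow k)]
    simp [h']
  unfold dunklD reflQuot dunklCoeff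
  rw [hp]
  beta_reduce
  rw [reflect_same]
  split_ifs with h
  · rw [h]
    rcases k with _ | _ | k
    · simp
    · simp only [zero_add, tsub_self, pow_zero, pow_one, Nat.cast_one]; ring
    · simp
  · have h' : (x i : ℂ) ≠ 0 := Complex.ofReal_ne_zero.2 h
    rcases k with _ | k
    · simp
    · push_cast
      rw [neg_pow (x i : ℂ)]
      field_simp
      ring

lemma partialDeriv_monoErase (i : Fin 3) (a : Fin 3 → ℕ) (x : E3) :
    partialDeriv i (monoErase i a) x = 0 := by
  have hd := (contDiff_monoErase i a (n := 1)).differentiable (by simp) x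
  unfold partialDeriv
  rw [← hd.lineDeriv_eq_fderiv]
  unfold lineDeriv
  have : (fun t : ℝ => monoErase i a (x + t • EuclideanSpace.single i (1 : ℝ)))
      = fun _ => monoErase i a x := by
    ext t
    refine Finset.prod_congr rfl fun j hj => ?_
    simp [Finset.ne_of_mem_erase hj]
  rw [this, deriv_const]

lemma dunklD_mono (μ : Fin 3 → ℝ) (i : Fin 3) (a : Fin 3 → ℕ) (x : E3) :
    dunklD μ i (mono a) x
      = dunklCoeff (μ i) (a i) * mono (Function.update a i (a i - 1)) x := by
  rw [show mono a = fun y => monoErase i a y * (y i : ℂ) ^ a i from funext (mono_eq i a),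
    dunklD_mul_of_invariant μ i ((contDiff_monoErase i a (n := 1)).differentiable (by simp) x)
      (((contDiff_coordC i (n := 1)).pow _).differentiable (by simp) x) ?_
      (fun _ => partialDeriv_monoErase i a x), partialDeriv_monoErase, dunklD_coord_pow,
    mono_update]
  · ring
  · refine Finset.prod_congr rfl fun j hj => ?_
    rw [reflect_ne (Finset.ne_of_mem_erase hj)]

lemma fderiv_mono_self (a : Fin 3 → ℕ) (x : E3) :
    fderiv ℝ (mono a) x x = ((∑ i, a i : ℕ) : ℂ) * mono a x := by
  rw [fderiv_self_eq_sum]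
  push_cast
  rw [Finset.sum_mul]
  refine Finset.sum_congr rfl fun i _ => ?_
  have h : partialDeriv i (mono a) x = a i * mono (Function.update a i (a i - 1)) x := by
    -- The partial derivative is the Dunkl operator with zero parameters.
    have := dunklD_mono (fun _ => 0) i a x
    simpa [dunklD, dunklCoeff] using this
  rw [h, mono_update, mono_eq i a]
  rcases Nat.eq_zero_or_pos (a i) with h0 | h0
  · simp [h0]
  · conv_rhs => rw [show a i = a i - 1 + 1 by omega, pow_succ]
    rw [Nat.sub_add_cancel h0]
    ring

/-- Truncated subtraction is harmless: for `a i = 0` or `1` one of the two coefficients is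
`dunklCoeff _ 0 = 0`. -/
lemma dunklD_dunklD_mono (μ : Fin 3 → ℝ) (i : Fin 3) (a : Fin 3 → ℕ) (x : E3) :
    dunklD μ i (dunklD μ i (mono a)) x
      = dunklCoeff (μ i) (a i) * dunklCoeff (μ i) (a i - 1)
        * mono (Function.update a i (a i - 2)) x := by
  rw [funext (dunklD_mono μ i a),
    dunklD_const_mul μ i, dunklD_mono]
  simp only [Function.update_self, Function.update_idem]
  rw [Nat.sub_sub, mul_assoc]

/-! ### Radial test functions -/

/-- Smooth functions on the line supported in `[3, 7]`. -/
structure IsTest (χ : ℝ → ℂ) : Prop where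
  contDiff : ContDiff ℝ ∞ χ
  eq_zero : ∀ t, t ∉ Icc (3 : ℝ) 7 → χ t = 0

lemma IsTest.deriv {χ : ℝ → ℂ} (h : IsTest χ) : IsTest (deriv χ) where
  contDiff := ((contDiff_infty_iff_deriv (𝕜 := ℝ)).1 h.contDiff).2
  eq_zero t ht := by
    have : χ =ᶠ[𝓝 t] fun _ => 0 := by
      filter_upwards [isClosed_Icc.isOpen_compl.mem_nhds ht] with s hs using h.eq_zero s hs
    rw [this.deriv_eq, deriv_const]

lemma IsTest.id_mul {χ : ℝ → ℂ} (h : IsTest χ) : IsTest (fun t => (t : ℂ) * χ t) where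
  contDiff := (Complex.ofRealCLM.contDiff).mul h.contDiff
  eq_zero t ht := by simp [h.eq_zero t ht]

lemma IsTest.hasDerivAt {χ : ℝ → ℂ} (h : IsTest χ) (t : ℝ) :
    HasDerivAt χ (_root_.deriv χ t) t :=
  (h.contDiff.differentiable (by simp) t).hasDerivAt

lemma IsTest.hasDerivAt_id_mul {χ : ℝ → ℂ} (h : IsTest χ) (t : ℝ) :
    HasDerivAt (fun t : ℝ => (t : ℂ) * χ t) (χ t + t * _root_.deriv χ t) t := by
  have := ((hasDerivAt_id t).ofReal_comp).fun_mul (h.hasDerivAt t)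
  simpa using this

lemma IsTest.contDiff_radial {χ : ℝ → ℂ} (h : IsTest χ) {n : ℕ} :
    ContDiff ℝ n (fun x : E3 => χ (‖x‖ ^ 2)) :=
  (h.contDiff.of_le (by exact_mod_cast le_top)).comp (contDiff_norm_sq ℝ)

/-! ### Moments of an eigenfunction against monomials -/

/-- The eigenvalue equation and homogeneity of degree zero on a spherical shell. -/
structure IsShellEigen (μ : Fin 3 → ℝ) (δ : ℂ) (F : E3 → ℂ) : Prop where
  contDiff : ContDiff ℝ 2 F
  bddSupp : BddSupp F
  laplacian : ∀ x : E3, ‖x‖ ^ 2 ∈ Icc (3 : ℝ) 7 →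
    ((‖x‖ ^ 2 : ℝ) : ℂ) * dunklLaplacian μ F x = δ * F x
  euler : ∀ x : E3, ‖x‖ ^ 2 ∈ Icc (3 : ℝ) 7 → fderiv ℝ F x x = 0

/-- The pairing of `F` with a monomial times a radial function. -/
def moment (μ : Fin 3 → ℝ) (F : E3 → ℂ) (a : Fin 3 → ℕ) (χ : ℝ → ℂ) : ℂ :=
  wint μ fun x => F x * (mono a x * χ (‖x‖ ^ 2))

lemma contDiff_moment_integrand {μ : Fin 3 → ℝ} {δ : ℂ} {F : E3 → ℂ}
    (hF : IsShellEigen μ δ F) (a : Fin 3 → ℕ) {χ : ℝ → ℂ} (hχ : IsTest χ) :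
    ContDiff ℝ 2 fun x => F x * (mono a x * χ (‖x‖ ^ 2)) :=
  hF.contDiff.mul ((contDiff_mono a).mul hχ.contDiff_radial)

/-- The integrated Euler identity applied to `F x^a χ(|x|²)`: the operator kills `F` on the shell,
multiplies `x^a` by its degree and sends `χ` to `2 t χ'`. -/
lemma moment_euler {μ : Fin 3 → ℝ} (hμ : ∀ i, -(1 / 2 : ℝ) < μ i) {δ : ℂ} {F : E3 → ℂ}
    (hF : IsShellEigen μ δ F) (a : Fin 3 → ℕ) {χ : ℝ → ℂ} (hχ : IsTest χ) :
    2 * moment μ F a (fun t => (t : ℂ) * deriv χ t)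
      = -(3 + 2 * ∑ i, (μ i : ℂ) + (∑ i, a i : ℕ)) * moment μ F a χ := by
  have hc := contDiff_moment_integrand hF a hχ
  have hb : BddSupp fun x => F x * (mono a x * χ (‖x‖ ^ 2)) := hF.bddSupp.mul_right _
  have h := wint_fderiv_self hμ (hc.of_le (by norm_num)) hb
  have hpt : ∀ x, fderiv ℝ (fun x => F x * (mono a x * χ (‖x‖ ^ 2))) x x
      = ((∑ i, a i : ℕ) : ℂ) * (F x * (mono a x * χ (‖x‖ ^ 2)))
        + 2 * (F x * (mono a x * (((‖x‖ ^ 2 : ℝ) : ℂ) * deriv χ (‖x‖ ^ 2)))) := by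
    intro x
    have h1 := hF.contDiff.differentiable (by simp) x
    have h2 := (contDiff_mono a (n := 1)).differentiable (by simp) x
    have h3 := (hχ.contDiff_radial (n := 1)).differentiable (by simp) x
    rw [fderiv_fun_mul h1 (h2.fun_mul h3), fderiv_fun_mul h2 h3]
    simp only [add_apply, smul_apply, smul_eq_mul]
    rw [fderiv_mono_self, fderiv_radial_self (hχ.hasDerivAt _)]
    by_cases hx : ‖x‖ ^ 2 ∈ Icc (3 : ℝ) 7
    · rw [hF.euler x hx]; ring
    · rw [hχ.eq_zero _ hx]; ring
  simp only [hpt] at h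
  rw [wint_add hμ (continuous_const.fun_mul hc.continuous) (hb.mul_left _)
    (continuous_const.fun_mul
      (contDiff_moment_integrand hF a hχ.deriv.id_mul).continuous)
    ((hF.bddSupp.mul_right _).mul_left _),
    wint_const_mul, wint_const_mul] at h
  unfold moment
  linear_combination h

lemma moment_add {μ : Fin 3 → ℝ} (hμ : ∀ i, -(1 / 2 : ℝ) < μ i) {δ : ℂ} {F : E3 → ℂ}
    (hF : IsShellEigen μ δ F) (a : Fin 3 → ℕ) {χ : ℝ → ℂ} (hχ : IsTest χ)
    {χ' : ℝ → ℂ} (hχ' : IsTest χ') :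
    moment μ F a (fun t => χ t + χ' t) = moment μ F a χ + moment μ F a χ' := by
  unfold moment
  rw [← wint_add hμ (contDiff_moment_integrand hF a hχ).continuous
    (hF.bddSupp.mul_right _) (contDiff_moment_integrand hF a hχ').continuous
    (hF.bddSupp.mul_right _)]
  simp only [mul_add]

lemma moment_const_mul (μ : Fin 3 → ℝ) (F : E3 → ℂ) (a : Fin 3 → ℕ) (c : ℂ) (χ : ℝ → ℂ) :
    moment μ F a (fun t => c * χ t) = c * moment μ F a χ := by
  unfold moment
  rw [← wint_const_mul]
  congr 1; ext x; ring

/-- Symmetry of `Δ` applied to `F` and `|x|² χ(|x|²) x^a`. The extra `|x|²` matches the equation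
`|x|² Δ F = δ F`, which is needed only on the support of `χ(|x|²)`. -/
lemma moment_laplacian {μ : Fin 3 → ℝ} (hμ : ∀ i, -(1 / 2 : ℝ) < μ i) {δ : ℂ} {F : E3 → ℂ}
    (hF : IsShellEigen μ δ F) (a : Fin 3 → ℕ) {χ : ℝ → ℂ} (hχ : IsTest χ) :
    δ * moment μ F a χ
      = ∑ i, dunklCoeff (μ i) (a i) * dunklCoeff (μ i) (a i - 1)
          * moment μ F (Function.update a i (a i - 2)) (fun t => (t : ℂ) * χ t)
        + (4 * moment μ F a (fun t => (t : ℂ) * deriv (fun t : ℝ => (t : ℂ) * deriv χ t) t)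
          + (4 + 2 * (2 * (∑ i, a i : ℕ) + 3 + 2 * ∑ i, (μ i : ℂ)))
            * moment μ F a (fun t => (t : ℂ) * deriv χ t)
          + 2 * (2 * (∑ i, a i : ℕ) + 3 + 2 * ∑ i, (μ i : ℂ)) * moment μ F a χ) := by
  set c : ℂ := 2 * (2 * (∑ i, a i : ℕ) + 3 + 2 * ∑ i, (μ i : ℂ)) with hc
  have hsymm := wint_dunklLaplacian_mul hμ hF.contDiff hF.bddSupp
    (v := fun x => ((‖x‖ ^ 2 : ℝ) : ℂ) * χ (‖x‖ ^ 2) * mono a x)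
    ((hχ.id_mul.contDiff_radial (n := 2)).mul (contDiff_mono a))
  have hl : wint μ (fun x => dunklLaplacian μ F x *
      (((‖x‖ ^ 2 : ℝ) : ℂ) * χ (‖x‖ ^ 2) * mono a x)) = δ * moment μ F a χ := by
    unfold moment
    rw [← wint_const_mul]
    congr 1; ext x
    by_cases hx : ‖x‖ ^ 2 ∈ Icc (3 : ℝ) 7
    · linear_combination (χ (‖x‖ ^ 2) * mono a x) * hF.laplacian x hx
    · rw [hχ.eq_zero _ hx]; ring
  have hη1 : ∀ t, HasDerivAt (fun t : ℝ => (t : ℂ) * χ t) (χ t + t * deriv χ t) t :=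
    hχ.hasDerivAt_id_mul
  have hη2 : ∀ t, HasDerivAt (fun t : ℝ => χ t + (t : ℂ) * deriv χ t)
      (deriv χ t + deriv (fun t : ℝ => (t : ℂ) * deriv χ t) t) t := fun t =>
    (hχ.hasDerivAt t).add (hχ.deriv.id_mul.hasDerivAt t)
  have hpt : ∀ x, F x * dunklLaplacian μ
        (fun x => ((‖x‖ ^ 2 : ℝ) : ℂ) * χ (‖x‖ ^ 2) * mono a x) x
      = ∑ i, dunklCoeff (μ i) (a i) * dunklCoeff (μ i) (a i - 1)
          * (F x * (mono (Function.update a i (a i - 2)) x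
            * (((‖x‖ ^ 2 : ℝ) : ℂ) * χ (‖x‖ ^ 2))))
        + F x * (mono a x * (4 * (((‖x‖ ^ 2 : ℝ) : ℂ)
              * deriv (fun t : ℝ => (t : ℂ) * deriv χ t) (‖x‖ ^ 2))
            + (4 + c) * (((‖x‖ ^ 2 : ℝ) : ℂ) * deriv χ (‖x‖ ^ 2)) + c * χ (‖x‖ ^ 2))) := by
    intro x
    rw [dunklLaplacian_radial_mul μ (η := fun t : ℝ => (t : ℂ) * χ t) isOpen_univ
      (fun t _ => hη1 t) (fun t _ => hη2 t) (contDiff_mono a) (mem_univ _) (fderiv_mono_self a x),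
      ← hc]
    simp only [dunklLaplacian, dunklD_dunklD_mono, Fin.sum_univ_three]
    ring
  rw [hl] at hsymm
  rw [hsymm]
  simp only [hpt]
  have t1 := hχ.deriv.id_mul
  have t2 := t1.deriv.id_mul
  have tc : ∀ {χ : ℝ → ℂ} (c : ℂ), IsTest χ → IsTest fun t => c * χ t := fun c h =>
    ⟨contDiff_const.mul h.contDiff, fun t ht => by simp [h.eq_zero t ht]⟩
  have ta : ∀ {χ χ' : ℝ → ℂ}, IsTest χ → IsTest χ' → IsTest fun t => χ t + χ' t := fun h h' =>
    ⟨h.contDiff.add h'.contDiff, fun t ht => by simp [h.eq_zero t ht, h'.eq_zero t ht]⟩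
  have s1 := tc 4 t2
  have s2 := tc (4 + c) t1
  have s3 := tc c hχ
  have s := ta (ta s1 s2) s3
  have hcs : ∀ i, Continuous fun x => dunklCoeff (μ i) (a i) * dunklCoeff (μ i) (a i - 1)
          * (F x * (mono (Function.update a i (a i - 2)) x
            * (((‖x‖ ^ 2 : ℝ) : ℂ) * χ (‖x‖ ^ 2)))) := fun i =>
    continuous_const.fun_mul (contDiff_moment_integrand hF _ hχ.id_mul).continuous
  have hbs : ∀ i, BddSupp fun x => dunklCoeff (μ i) (a i) * dunklCoeff (μ i) (a i - 1)
          * (F x * (mono (Function.update a i (a i - 2)) x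
            * (((‖x‖ ^ 2 : ℝ) : ℂ) * χ (‖x‖ ^ 2)))) := fun i =>
    (hF.bddSupp.mul_right _).mul_left _
  rw [wint_add hμ (continuous_finsetSum _ fun i _ => hcs i) ?_
    (contDiff_moment_integrand hF a s).continuous (hF.bddSupp.mul_right _),
    wint_sum hμ _ hcs hbs]
  · congr 1
    · exact Finset.sum_congr rfl fun i _ => wint_const_mul _ _ _
    · rw [← moment_const_mul, ← moment_const_mul, ← moment_const_mul,
        ← moment_add hμ hF a s1 s2, ← moment_add hμ hF a (ta s1 s2) s3]
      rfl
  · obtain ⟨R, hR⟩ := hF.bddSupp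
    exact ⟨R, fun x hx => by simp [hR x hx]⟩

/-- If `δ` is none of the `-N (N + 2γ + 1)`, all moments vanish. -/
theorem moment_eq_zero {μ : Fin 3 → ℝ} (hμ : ∀ i, -(1 / 2 : ℝ) < μ i) {δ : ℂ} {F : E3 → ℂ}
    (hF : IsShellEigen μ δ F)
    (hδ : ∀ N : ℕ, δ ≠ -(N : ℂ) * (N + 2 * ∑ i, (μ i : ℂ) + 1)) :
    ∀ (N : ℕ) (a : Fin 3 → ℕ), ∑ i, a i = N → ∀ χ, IsTest χ → moment μ F a χ = 0 := by
  intro N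
  induction N using Nat.strong_induction_on with
  | _ N ih =>
    intro a ha χ hχ
    have hlow : ∀ i, dunklCoeff (μ i) (a i) * dunklCoeff (μ i) (a i - 1)
        * moment μ F (Function.update a i (a i - 2)) (fun t => (t : ℂ) * χ t) = 0 := by
      intro i
      by_cases h2 : 2 ≤ a i
      · have hs : ∑ j, Function.update a i (a i - 2) j < N := by
          rw [← ha]
          refine Finset.sum_lt_sum (fun j _ => ?_) ⟨i, Finset.mem_univ i, ?_⟩
          · by_cases hj : j = i
            · subst hj; simp
            · simp [hj]
          · simp; omega
        rw [ih _ hs _ rfl _ hχ.id_mul, mul_zero]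
      · have h : a i = 0 ∨ a i = 1 := by omega
        rcases h with h | h <;> simp [h, dunklCoeff_zero]
    have h1 := moment_laplacian hμ hF a hχ
    have h2 := moment_euler hμ hF a hχ
    have h3 := moment_euler hμ hF a hχ.deriv.id_mul
    rw [Finset.sum_eq_zero fun i _ => hlow i] at h1
    rw [ha] at h1 h2 h3
    set S : ℂ := ∑ i, (μ i : ℂ)
    -- With `A = 3 + 2 S`, each `t d/dt` on `χ` acts on moments as `-(A + N) / 2`, and `(A + N)² -
    -- (2 + 2 N + A)(A + N) + 2 (2 N + A) = -N (N + A - 2)`. Here `h3` removes the second-order term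
    -- and the remaining first-order terms are collected on `h2`.
    have hz : (δ - -(N : ℂ) * (N + 2 * S + 1)) * moment μ F a χ = 0 := by
      linear_combination h1 + 2 * h3 + (4 + 2 * (2 * N + 3 + 2 * S)
        - 2 * (3 + 2 * S + N)) / 2 * h2
    exact (mul_eq_zero.1 hz).resolve_left (sub_ne_zero.2 (hδ N))

/-! ### Density of polynomials -/

/-- The coordinates as continuous functions on a subset. -/
def coordFun (K : Set E3) (i : Fin 3) : C(K, ℝ) := ⟨fun x => (x : E3) i, by fun_prop⟩

lemma exists_polynomial_near {K : Set E3} (hK : IsCompact K) {u : E3 → ℝ} (hu : Continuous u)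
    {ε : ℝ} (hε : 0 < ε) :
    ∃ P : MvPolynomial (Fin 3) ℝ, ∀ x ∈ K, |MvPolynomial.eval x.ofLp P - u x| < ε := by
  have : CompactSpace K := isCompact_iff_compactSpace.1 hK
  have hsep : (MvPolynomial.aeval (R := ℝ) (coordFun K)).range.SeparatesPoints := by
    intro x y hxy
    have : ∃ i, (x : E3) i ≠ (y : E3) i := by
      by_contra! h
      exact hxy (Subtype.ext (PiLp.ext h))
    obtain ⟨i, hi⟩ := this
    exact ⟨coordFun K i, ⟨coordFun K i, ⟨MvPolynomial.X i, by simp⟩, rfl⟩, hi⟩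
  obtain ⟨⟨g, P, hP⟩, hg⟩ :=
    ContinuousMap.exists_mem_subalgebra_near_continuous_of_separatesPoints _ hsep
      (fun x : K => u x) (by fun_prop) ε hε
  refine ⟨P, fun x hx => ?_⟩
  have h1 := hg ⟨x, hx⟩
  have h2 : g ⟨x, hx⟩ = MvPolynomial.eval x.ofLp P := by
    rw [← hP]
    have := MvPolynomial.map_aeval (coordFun K)
      ((ContinuousMap.evalAlgHom ℝ ℝ (⟨x, hx⟩ : K)).toRingHom) P
    simp only [AlgHom.toRingHom_eq_coe, RingHom.coe_coe] at this
    change ContinuousMap.evalAlgHom ℝ ℝ (⟨x, hx⟩ : K) (MvPolynomial.aeval (coordFun K) P) = _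
    rw [this, MvPolynomial.coe_eval₂Hom, MvPolynomial.eval, MvPolynomial.coe_eval₂Hom]
    congr 1
  rw [Real.norm_eq_abs] at h1
  simpa [h2] using h1

lemma eval_eq_sum_mono (P : MvPolynomial (Fin 3) ℝ) (x : E3) :
    ((MvPolynomial.eval x.ofLp P : ℝ) : ℂ) = ∑ d ∈ P.support, ((P.coeff d : ℝ) : ℂ) * mono d x := by
  rw [MvPolynomial.eval_eq']
  push_cast
  rfl

/-- Approximate `u` uniformly by polynomials on a ball outside which `G` vanishes; the error is at
most `ε` times the weighted `L¹` norm of `G`. -/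
lemma wint_mul_real_eq_zero {μ : Fin 3 → ℝ} (hμ : ∀ i, -(1 / 2 : ℝ) < μ i) {G : E3 → ℂ}
    (hG : Continuous G) (hb : BddSupp G) (h : ∀ a, wint μ (fun x => G x * mono a x) = 0)
    {u : E3 → ℝ} (hu : Continuous u) : wint μ (fun x => G x * u x) = 0 := by
  have hGi := integrable_weight_mul hμ hG hb
  set C := ∫ x, ‖(weight μ x : ℂ) * G x‖ with hC
  have hbb := hb
  obtain ⟨R, hR⟩ := hbb
  have key : ∀ ε : ℝ, 0 < ε → ‖wint μ (fun x => G x * u x)‖ ≤ ε * C := by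
    intro ε hε
    obtain ⟨P, hP⟩ := exists_polynomial_near (isCompact_closedBall (0 : E3) R) hu hε
    have hPc : Continuous fun x : E3 => ((MvPolynomial.eval x.ofLp P : ℝ) : ℂ) := by
      simp only [eval_eq_sum_mono]
      exact continuous_finsetSum _ fun d _ =>
        continuous_const.mul (contDiff_mono (d : Fin 3 → ℕ) (n := 0)).continuous
    have huc : Continuous fun x => (u x : ℂ) := Complex.continuous_ofReal.comp hu
    have h0 : wint μ (fun x => G x * ((MvPolynomial.eval x.ofLp P : ℝ) : ℂ)) = 0 := by
      simp only [eval_eq_sum_mono, Finset.mul_sum]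
      rw [wint_sum hμ]
      · refine Finset.sum_eq_zero fun d _ => ?_
        have := wint_const_mul μ ((P.coeff d : ℝ) : ℂ) (fun x => G x * mono d x)
        rw [h, mul_zero] at this
        rw [← this]
        congr 1; ext x; ring
      · exact fun d => hG.mul (continuous_const.mul
          (contDiff_mono (d : Fin 3 → ℕ) (n := 0)).continuous)
      · exact fun d => hb.mul_right _
    have h1 : wint μ (fun x => G x * u x)
        = wint μ (fun x => G x * (u x - ((MvPolynomial.eval x.ofLp P : ℝ) : ℂ))) := by
      have := wint_add hμ (F := fun x => G x * (u x - ((MvPolynomial.eval x.ofLp P : ℝ) : ℂ)))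
        (G := fun x => G x * ((MvPolynomial.eval x.ofLp P : ℝ) : ℂ))
        (hG.mul (huc.sub hPc)) (hb.mul_right _) (hG.mul hPc) (hb.mul_right _)
      rw [h0, add_zero] at this
      rw [← this]
      congr 1; ext x; ring
    rw [h1, hC, ← integral_const_mul]
    refine norm_integral_le_of_norm_le (hGi.norm.const_mul ε) (ae_of_all _ fun x => ?_)
    by_cases hx : ‖x‖ ≤ R
    · rw [← mul_assoc, norm_mul, mul_comm]
      refine mul_le_mul_of_nonneg_right ?_ (norm_nonneg _)
      rw [← Complex.ofReal_sub, Complex.norm_real, Real.norm_eq_abs, abs_sub_comm]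
      exact (hP x (by simpa using hx)).le
    · simp [hR x (not_le.1 hx)]
  have hlim : Tendsto (fun ε : ℝ => ε * C) (𝓝[>] 0) (𝓝 0) := by
    have : Tendsto (fun ε : ℝ => ε * C) (𝓝 0) (𝓝 (0 * C)) :=
      (continuous_id.mul continuous_const).tendsto 0
    rw [zero_mul] at this
    exact this.mono_left nhdsWithin_le_nhds
  have := ge_of_tendsto hlim (eventually_nhdsWithin_of_forall fun ε hε => key ε hε)
  exact norm_le_zero_iff.1 this

lemma ae_weight_pos (μ : Fin 3 → ℝ) : ∀ᵐ x : E3, 0 < weight μ x := by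
  have h : ∀ i : Fin 3, ∀ᵐ x : E3, x i ≠ 0 := by
    intro i
    have h0 : volume ((LinearMap.ker (EuclideanSpace.proj i : E3 →L[ℝ] ℝ).toLinearMap :
        Submodule ℝ E3) : Set E3) = 0 := by
      refine Measure.addHaar_submodule _ _ fun htop => ?_
      have : EuclideanSpace.single i (1 : ℝ) ∈
          LinearMap.ker (EuclideanSpace.proj i : E3 →L[ℝ] ℝ).toLinearMap := by
        rw [htop]; trivial
      simp at this
    rw [ae_iff]
    convert h0 using 2
    ext x; simp
  filter_upwards [ae_all_iff.2 h] with x hx using weight_pos μ hx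

/-- Testing `F ψ` against the real and imaginary parts of `F` gives `∫ w ψ |F|² = 0`. The weight is
positive almost everywhere, so the continuous function `ψ |F|²` vanishes identically. -/
theorem eq_zero_of_wint_mono_eq_zero {μ : Fin 3 → ℝ} (hμ : ∀ i, -(1 / 2 : ℝ) < μ i) {F : E3 → ℂ}
    (hF : Continuous F) {ψ : E3 → ℝ} (hψ : Continuous ψ) (hψ0 : ∀ x, 0 ≤ ψ x)
    (hb : BddSupp fun x => F x * ψ x)
    (h : ∀ a, wint μ (fun x => F x * ψ x * mono a x) = 0) {x : E3} (hx : ψ x ≠ 0) : F x = 0 := by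
  have hG : Continuous fun x => F x * ψ x := hF.mul (Complex.continuous_ofReal.comp hψ)
  have hre := wint_mul_real_eq_zero hμ hG hb h (Complex.continuous_re.comp hF)
  have him := wint_mul_real_eq_zero hμ hG hb h (Complex.continuous_im.comp hF)
  have hq : Continuous fun x => ψ x * Complex.normSq (F x) :=
    hψ.mul (Complex.continuous_normSq.comp hF)
  have hqb : BddSupp fun x => ((ψ x * Complex.normSq (F x) : ℝ) : ℂ) := by
    obtain ⟨R, hR⟩ := hb
    refine ⟨R, fun x hx => ?_⟩
    have := hR x hx
    rcases mul_eq_zero.1 this with h | h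
    · simp [h]
    · simp [Complex.ofReal_eq_zero.1 h]
  have hqi := integrable_weight_mul hμ (Complex.continuous_ofReal.comp hq) hqb
  have h0 : wint μ (fun x => ((ψ x * Complex.normSq (F x) : ℝ) : ℂ)) = 0 := by
    have hrec : Continuous fun x => ((F x).re : ℂ) :=
      Complex.continuous_ofReal.comp (Complex.continuous_re.comp hF)
    have himc : Continuous fun x => ((F x).im : ℂ) :=
      Complex.continuous_ofReal.comp (Complex.continuous_im.comp hF)
    have h1 := wint_add hμ (F := fun x => F x * ψ x * ((F x).re : ℂ))
      (G := fun x => -Complex.I * (F x * ψ x * ((F x).im : ℂ)))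
      (hG.mul hrec) (hb.mul_right _) (continuous_const.mul (hG.mul himc))
      ((hb.mul_right _).mul_left _)
    rw [wint_const_mul] at h1
    simp only [Function.comp_def] at hre him
    rw [hre, him, mul_zero, add_zero] at h1
    rw [← h1]
    congr 1; ext x
    push_cast
    rw [Complex.normSq_eq_conj_mul_self]
    have : (starRingEnd ℂ) (F x) = (F x).re - Complex.I * (F x).im := by
      apply Complex.ext <;> simp
    rw [this]; ring
  have h0' : ∫ x, weight μ x * (ψ x * Complex.normSq (F x)) = 0 := by
    unfold wint at h0
    have : (fun x => (weight μ x : ℂ) * ((ψ x * Complex.normSq (F x) : ℝ) : ℂ))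
        = fun x => ((weight μ x * (ψ x * Complex.normSq (F x)) : ℝ) : ℂ) := by
      ext x; push_cast; ring
    rw [this, integral_complex_ofReal] at h0
    exact_mod_cast h0
  have hqi' : Integrable fun x => weight μ x * (ψ x * Complex.normSq (F x)) := by
    have := hqi.re
    refine this.congr (ae_of_all _ fun x => ?_)
    simp
  rw [integral_eq_zero_iff_of_nonneg (fun x => mul_nonneg (weight_nonneg μ x)
    (mul_nonneg (hψ0 x) (Complex.normSq_nonneg _))) hqi'] at h0'
  have hae : (fun x => ψ x * Complex.normSq (F x)) =ᵐ[volume] fun _ => 0 := by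
    filter_upwards [h0', ae_weight_pos μ] with x h1 h2
    exact (mul_eq_zero.1 h1).resolve_left h2.ne'
  have := congrFun ((Continuous.ae_eq_iff_eq volume hq continuous_const).1 hae) x
  exact Complex.normSq_eq_zero.1 ((mul_eq_zero.1 this).resolve_left hx)

theorem IsShellEigen.eq_zero {μ : Fin 3 → ℝ} (hμ : ∀ i, -(1 / 2 : ℝ) < μ i) {δ : ℂ} {F : E3 → ℂ}
    (hF : IsShellEigen μ δ F)
    (hδ : ∀ N : ℕ, δ ≠ -(N : ℂ) * (N + 2 * ∑ i, (μ i : ℂ) + 1)) {x : E3} (hx : ‖x‖ ^ 2 = 5) :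
    F x = 0 := by
  -- The outer radius `2` about `5` puts the support in `[3, 7]`, as `IsTest` requires.
  let b : ContDiffBump (5 : ℝ) := ⟨1, 2, one_pos, one_lt_two⟩
  have hb : IsTest fun t => ((b t : ℝ) : ℂ) := by
    refine ⟨Complex.ofRealCLM.contDiff.comp b.contDiff, fun t ht => ?_⟩
    rw [b.zero_of_le_dist, Complex.ofReal_zero]
    by_contra! h
    rw [Real.dist_eq, abs_lt] at h
    have hr : b.rOut = 2 := rfl
    exact ht ⟨by linarith [h.1], by linarith [h.2]⟩
  refine eq_zero_of_wint_mono_eq_zero hμ hF.contDiff.continuous (ψ := fun x => b (‖x‖ ^ 2))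
    (b.continuous.comp (by fun_prop)) (fun x => b.nonneg) (hF.bddSupp.mul_right _) (fun a => ?_) ?_
  · rw [← moment_eq_zero hμ hF hδ _ a rfl _ hb]
    unfold moment
    congr 1; ext x; ring
  · have : b (‖x‖ ^ 2) = 1 := b.one_of_mem_closedBall (by rw [hx]; simp [b])
    rw [this]; exact one_ne_zero

/-! ### Dilations -/

lemma dunklD_comp_smul (μ : Fin 3 → ℝ) (i : Fin 3) (F : E3 → ℂ) {c : ℝ} (hc : c ≠ 0) (x : E3) :
    dunklD μ i (fun y => F (c • y)) x = c * dunklD μ i F (c • x) := by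
  have hp : partialDeriv i (fun y => F (c • y)) x = c * partialDeriv i F (c • x) := by
    simp [partialDeriv, fderiv_comp_smul]
  have hc' : (c : ℂ) ≠ 0 := Complex.ofReal_ne_zero.2 hc
  unfold dunklD reflQuot
  simp only [hp, reflect_smul, PiLp.smul_apply, smul_eq_mul, mul_eq_zero, hc, false_or]
  split_ifs with h
  · ring
  · have h' : (x i : ℂ) ≠ 0 := Complex.ofReal_ne_zero.2 h
    push_cast
    field_simp

lemma dunklLaplacian_comp_smul (μ : Fin 3 → ℝ) (F : E3 → ℂ) {c : ℝ} (hc : c ≠ 0) (x : E3) :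
    dunklLaplacian μ (fun y => F (c • y)) x = (c : ℂ) ^ 2 * dunklLaplacian μ F (c • x) := by
  unfold dunklLaplacian
  rw [Finset.mul_sum]
  refine Finset.sum_congr rfl fun i _ => ?_
  rw [funext fun y => dunklD_comp_smul μ i F hc y,
    dunklD_const_mul, dunklD_comp_smul μ i (dunklD μ i F) hc]
  ring

/-! ### Homogeneous extensions of functions on the sphere -/

lemma radialExt_of_ne_zero (f : S2 → ℂ) {x : E3} (hx : x ≠ 0) :
    radialExt f x = f (proj x hx) := by simp [radialExt, hx]

lemma radialExt_coe (f : S2 → ℂ) (ξ : S2) : radialExt f (ξ : E3) = f ξ := by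
  have hn : ‖(ξ : E3)‖ = 1 := by simp
  rw [radialExt_of_ne_zero f (norm_ne_zero_iff.1 (by rw [hn]; exact one_ne_zero))]
  congr 1
  ext1
  simp [proj]

lemma radialExt_smul (f : S2 → ℂ) {c : ℝ} (hc : 0 < c) (x : E3) :
    radialExt f (c • x) = radialExt f x := by
  by_cases hx : x = 0
  · simp [hx]
  · rw [radialExt_of_ne_zero f hx, radialExt_of_ne_zero f (smul_ne_zero hc.ne' hx)]
    congr 1
    ext1
    simp only [proj, norm_smul, Real.norm_of_nonneg hc.le, smul_smul]
    congr 1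
    field_simp

lemma contDiffAt_radialExt {n : WithTop ℕ∞} {f : S2 → ℂ} (hf : ContMDiff (𝓡 2) 𝓘(ℝ, ℂ) n f)
    {x : E3} (hx : x ≠ 0) : ContDiffAt ℝ n (radialExt f) x := by
  let U : TopologicalSpace.Opens E3 := ⟨{0}ᶜ, isOpen_compl_singleton⟩
  have hU : ∀ y : U, (y : E3) ≠ 0 := fun y => y.2
  have h1 : ContMDiff 𝓘(ℝ, E3) 𝓘(ℝ, E3) n (fun y : U => ‖(y : E3)‖⁻¹ • (y : E3)) := by
    intro y
    rw [contMDiffAt_subtype_iff (f := fun z : E3 => ‖z‖⁻¹ • z), contMDiffAt_iff_contDiffAt]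
    exact ((contDiffAt_norm ℝ (hU y)).inv (norm_ne_zero_iff.2 (hU y))).smul contDiffAt_id
  have h2 : ∀ y : U, ‖(y : E3)‖⁻¹ • (y : E3) ∈ Metric.sphere (0 : E3) 1 := fun y =>
    (proj y (hU y)).2
  have h3 := hf.comp (h1.codRestrict_sphere (n := 2) h2)
  have h4 := h3 ⟨x, hx⟩
  have h5 : (f ∘ Set.codRestrict (fun y : U => ‖(y : E3)‖⁻¹ • (y : E3)) _ h2)
      = fun y : U => radialExt f y := by
    ext y
    rw [radialExt_of_ne_zero f (hU y)]; rfl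
  rw [h5, contMDiffAt_subtype_iff, contMDiffAt_iff_contDiffAt] at h4
  exact h4

lemma fderiv_radialExt_self {n : WithTop ℕ∞} (hn : n ≠ 0) {f : S2 → ℂ}
    (hf : ContMDiff (𝓡 2) 𝓘(ℝ, ℂ) n f) {x : E3} (hx : x ≠ 0) :
    fderiv ℝ (radialExt f) x x = 0 := by
  rw [← ((contDiffAt_radialExt hf hx).differentiableAt hn).lineDeriv_eq_fderiv]
  unfold lineDeriv
  have : (fun t : ℝ => radialExt f (x + t • x)) =ᶠ[𝓝 0] fun _ => radialExt f x := by
    filter_upwards [Ioi_mem_nhds (show (-1 : ℝ) < 0 by norm_num)] with t ht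
    rw [show x + t • x = (1 + t) • x by rw [add_smul, one_smul]]
    exact radialExt_smul f (by linarith [show (-1 : ℝ) < t from ht]) x
  rw [this.deriv_eq, deriv_const]

/-- The extension is dilation invariant and `Δ` has degree `-2`; rescaling by `1 / |x|` moves the
computation to the unit sphere. -/
lemma norm_sq_mul_dunklLaplacian_radialExt (μ : Fin 3 → ℝ) (f : S2 → ℂ) {x : E3} (hx : x ≠ 0) :
    ((‖x‖ ^ 2 : ℝ) : ℂ) * dunklLaplacian μ (radialExt f) x = dunklLaplacianS2 μ f (proj x hx) := by
  have hn : ‖x‖ ≠ 0 := norm_ne_zero_iff.2 hx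
  have h := dunklLaplacian_comp_smul μ (radialExt f) (inv_ne_zero hn) x
  rw [funext fun y => radialExt_smul f (inv_pos.2 (norm_pos_iff.2 hx)) y] at h
  have hn' : (‖x‖ : ℂ) ≠ 0 := Complex.ofReal_ne_zero.2 hn
  rw [h, dunklLaplacianS2, proj]
  push_cast
  field_simp

/-- A radial cut-off of the homogeneous extension. -/
lemma exists_isShellEigen {μ : Fin 3 → ℝ} {n : WithTop ℕ∞} (hn : 2 ≤ n) {δ : ℂ} {f : S2 → ℂ}
    (hf : ContMDiff (𝓡 2) 𝓘(ℝ, ℂ) n f) (h : ∀ ξ, dunklLaplacianS2 μ f ξ = δ * f ξ) :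
    ∃ F : E3 → ℂ, IsShellEigen μ δ F ∧ ∀ x, ‖x‖ ^ 2 = 5 → F x = radialExt f x := by
  -- This cut-off is `1` on `(2, 8)`, an open neighbourhood of the shell `[3, 7]`, so there `F` and
  -- `radialExt f` have the same derivatives. It vanishes for `|x|² ≤ 1`, which removes the
  -- singularity at the origin.
  let b : ContDiffBump (5 : ℝ) := ⟨3, 4, by norm_num, by norm_num⟩
  have hr : b.rOut = 4 := rfl
  have hb0 : ∀ t : ℝ, t ≤ 1 ∨ 9 ≤ t → b t = 0 := fun t ht => by
    refine b.zero_of_le_dist ?_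
    rw [Real.dist_eq, le_abs, hr]
    rcases ht with ht | ht
    · right; linarith
    · left; linarith
  have hb1 : ∀ t : ℝ, t ∈ Ioo (2 : ℝ) 8 → b t = 1 := fun t ht => by
    refine b.one_of_mem_closedBall ?_
    rw [Metric.mem_closedBall, Real.dist_eq, abs_le]
    exact ⟨by linarith [ht.1, show b.rIn = 3 from rfl], by linarith [ht.2, show b.rIn = 3 from rfl]⟩
  have hf2 : ContMDiff (𝓡 2) 𝓘(ℝ, ℂ) 2 f := hf.of_le hn
  set F : E3 → ℂ := fun x => (b (‖x‖ ^ 2) : ℂ) * radialExt f x with hF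
  have heq : ∀ x : E3, ‖x‖ ∈ (fun r : ℝ => r ^ 2) ⁻¹' Ioo 2 8 → F x = radialExt f x := by
    intro x hx
    have hx' : ‖x‖ ^ 2 ∈ Ioo (2 : ℝ) 8 := hx
    simp [hF, hb1 _ hx']
  have hop : IsOpen ((fun r : ℝ => r ^ 2) ⁻¹' Ioo 2 8) := isOpen_Ioo.preimage (by fun_prop)
  have hmem : ∀ x : E3, ‖x‖ ^ 2 ∈ Icc (3 : ℝ) 7 → ‖x‖ ∈ (fun r : ℝ => r ^ 2) ⁻¹' Ioo 2 8 :=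
    fun x hx => ⟨by linarith [hx.1], by linarith [hx.2]⟩
  have hne : ∀ x : E3, ‖x‖ ^ 2 ∈ Icc (3 : ℝ) 7 → x ≠ 0 := by
    rintro x hx rfl
    norm_num at hx
  refine ⟨F, ⟨?_, ?_, ?_, ?_⟩, fun x hx => heq x ?_⟩
  · rw [contDiff_iff_contDiffAt]
    intro x
    by_cases hx : x = 0
    · have : F =ᶠ[𝓝 x] fun _ => 0 := by
        subst hx
        filter_upwards [Metric.ball_mem_nhds (0 : E3) one_pos] with y hy
        rw [mem_ball_zero_iff] at hy
        simp [hF, hb0 (‖y‖ ^ 2) (Or.inl (by nlinarith [norm_nonneg y]))]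
      exact contDiffAt_const.congr_of_eventuallyEq this
    · refine ContDiffAt.mul ?_ (contDiffAt_radialExt hf2 hx)
      exact (Complex.ofRealCLM.contDiff.comp (b.contDiff.comp (contDiff_norm_sq ℝ))).contDiffAt
  · exact ⟨3, fun x hx => by simp [hF, hb0 (‖x‖ ^ 2) (Or.inr (by nlinarith))]⟩
  · intro x hx
    rw [dunklLaplacian_congr μ hop heq (hmem x hx),
      norm_sq_mul_dunklLaplacian_radialExt μ f (hne x hx), h, heq x (hmem x hx),
      radialExt_of_ne_zero f (hne x hx)]
  · intro x hx
    have : F =ᶠ[𝓝 x] radialExt f := by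
      filter_upwards [(hop.preimage continuous_norm).mem_nhds (hmem x hx)] with y hy using heq y hy
    rw [this.fderiv_eq]
    exact fderiv_radialExt_self two_ne_zero hf2 (hne x hx)
  · exact hmem x (by rw [hx]; norm_num)

theorem exists_eq_of_isEigenvalueS2 {μ : Fin 3 → ℝ} (hμ : ∀ i, -(1 / 2 : ℝ) < μ i)
    {n : WithTop ℕ∞} (hn : 2 ≤ n) {δ : ℂ} (hδ : IsEigenvalueS2 μ n δ) :
    ∃ N : ℕ, δ = -(N : ℂ) * (N + 2 * ∑ i, (μ i : ℂ) + 1) := by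
  obtain ⟨f, hf, hf0, h⟩ := hδ
  by_contra! hN
  obtain ⟨F, hF, hFf⟩ := exists_isShellEigen hn hf h
  refine hf0 (funext fun ξ => ?_)
  have hpos : (0 : ℝ) < √5 := Real.sqrt_pos.2 (by norm_num)
  have hx : ‖√5 • (ξ : E3)‖ ^ 2 = 5 := by
    rw [norm_smul, Real.norm_of_nonneg hpos.le]; simp
  rw [Pi.zero_apply, ← radialExt_coe f ξ, ← radialExt_smul f hpos, ← hFf _ hx]
  exact hF.eq_zero hμ hN hx

/-! ### Existence of harmonic polynomials -/

lemma mono_smul (a : Fin 3 → ℕ) (c : ℝ) (x : E3) :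
    mono a (c • x) = (c : ℂ) ^ (∑ i, a i) * mono a x := by
  unfold mono
  rw [← Finset.prod_pow_eq_pow_sum, ← Finset.prod_mul_distrib]
  refine Finset.prod_congr rfl fun i _ => ?_
  simp [mul_pow]

/-- The coefficient in `D ^ 2 x ^ (2 j) = evenCoeff m j * x ^ (2 j - 2)`. -/
def evenCoeff (m : ℝ) (j : ℕ) : ℂ := dunklCoeff m (2 * j) * dunklCoeff m (2 * j - 1)

lemma evenCoeff_zero (m : ℝ) : evenCoeff m 0 = 0 := by simp [evenCoeff, dunklCoeff_zero]

lemma evenCoeff_succ (m : ℝ) (j : ℕ) :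
    evenCoeff m (j + 1) = ((2 * (j + 1) * (2 * j + 1 + 2 * m) : ℝ) : ℂ) := by
  have h1 : 2 * (j + 1) - 1 = 2 * j + 1 := by omega
  unfold evenCoeff dunklCoeff
  rw [h1, pow_succ (-1 : ℂ) (2 * j), pow_mul, pow_mul, neg_one_sq, one_pow,
    one_pow]
  push_cast
  ring

lemma evenCoeff_succ_ne_zero {m : ℝ} (hm : -(1 / 2 : ℝ) < m) (j : ℕ) :
    evenCoeff m (j + 1) ≠ 0 := by
  rw [evenCoeff_succ, Complex.ofReal_ne_zero]
  have : (0 : ℝ) ≤ j := j.cast_nonneg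
  have : (0 : ℝ) < 2 * j + 1 + 2 * m := by linarith
  positivity

/-- The coefficients of a Dunkl harmonic polynomial in two variables. -/
def harmCoeff (μ : Fin 3 → ℝ) (k : ℕ) : ℕ → ℂ
  | 0 => 1
  | j + 1 => -(harmCoeff μ k j) * evenCoeff (μ 1) (k - j) / evenCoeff (μ 0) (j + 1)

/-- A Dunkl harmonic polynomial that is homogeneous of degree `2 k + e` for `e ≤ 1`. -/
def harm (μ : Fin 3 → ℝ) (k e : ℕ) (x : E3) : ℂ :=
  ∑ j ∈ Finset.range (k + 1), harmCoeff μ k j * mono ![2 * j, 2 * (k - j), e] x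

lemma contDiff_harm (μ : Fin 3 → ℝ) (k e : ℕ) {n : WithTop ℕ∞} : ContDiff ℝ n (harm μ k e) := by
  unfold harm
  exact ContDiff.sum fun j _ => contDiff_const.mul (contDiff_mono _)

lemma harm_smul (μ : Fin 3 → ℝ) (k e : ℕ) (c : ℝ) (x : E3) :
    harm μ k e (c • x) = (c : ℂ) ^ (2 * k + e) * harm μ k e x := by
  unfold harm
  rw [Finset.mul_sum]
  refine Finset.sum_congr rfl fun j hj => ?_
  have hj' : j ≤ k := Nat.lt_succ_iff.1 (Finset.mem_range.1 hj)
  have hs : ∑ i, ![2 * j, 2 * (k - j), e] i = 2 * k + e := by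
    simp [Fin.sum_univ_three]; omega
  rw [mono_smul, hs]; ring

lemma fderiv_harm_self (μ : Fin 3 → ℝ) (k e : ℕ) (x : E3) :
    fderiv ℝ (harm μ k e) x x = ((2 * k + e : ℕ) : ℂ) * harm μ k e x := by
  have hd : ∀ a, DifferentiableAt ℝ (mono a) x := fun a =>
    (contDiff_mono a (n := 1)).differentiable (by simp) x
  have h : HasFDerivAt (harm μ k e) (∑ j ∈ Finset.range (k + 1),
      harmCoeff μ k j • fderiv ℝ (mono ![2 * j, 2 * (k - j), e]) x) x :=
    HasFDerivAt.fun_sum fun j _ => (hd _).hasFDerivAt.const_mul _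
  rw [h.fderiv, sum_apply, harm, Finset.mul_sum]
  refine Finset.sum_congr rfl fun j hj => ?_
  have hj' : j ≤ k := Nat.lt_succ_iff.1 (Finset.mem_range.1 hj)
  have hs : ∑ i, ![2 * j, 2 * (k - j), e] i = 2 * k + e := by
    simp [Fin.sum_univ_three]; omega
  rw [smul_apply, fderiv_mono_self, hs, smul_eq_mul]; ring

/-- `D_3²` kills `x_3^e` for `e ≤ 1`. In the other two variables the sums for `D_1²` and `D_2²`
involve the same monomials after an index shift and cancel term by term by the recursion for
`harmCoeff`; its denominators are nonzero because `μ_1 > -1/2`. -/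
lemma dunklLaplacian_harm {μ : Fin 3 → ℝ} (hμ : ∀ i, -(1 / 2 : ℝ) < μ i) (k : ℕ) {e : ℕ}
    (he : e ≤ 1) (x : E3) : dunklLaplacian μ (harm μ k e) x = 0 := by
  have hterm : ∀ i, dunklD μ i (dunklD μ i (harm μ k e)) x
      = ∑ j ∈ Finset.range (k + 1), harmCoeff μ k j *
        dunklD μ i (dunklD μ i (mono ![2 * j, 2 * (k - j), e])) x := by
    intro i
    have h1 : dunklD μ i (harm μ k e) = fun y => ∑ j ∈ Finset.range (k + 1), harmCoeff μ k j *
        dunklD μ i (mono ![2 * j, 2 * (k - j), e]) y := by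
      ext y
      unfold harm
      rw [dunklD_sum μ i _ fun j =>
        ((contDiff_const.mul (contDiff_mono _ (n := 1))).differentiable (by simp) y)]
      exact Finset.sum_congr rfl fun j _ => dunklD_const_mul μ i _ _ y
    rw [h1, dunklD_sum μ i _ fun j => ((contDiff_const.mul
      (contDiff_dunklD μ i (contDiff_mono _))).differentiable (by simp) x)]
    exact Finset.sum_congr rfl fun j _ => dunklD_const_mul μ i _ _ x
  unfold dunklLaplacian
  rw [Fin.sum_univ_three, hterm, hterm, hterm]
  simp only [dunklD_dunklD_mono]
  have hz : ∀ j, dunklCoeff (μ 2) (![2 * j, 2 * (k - j), e] 2)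
      * dunklCoeff (μ 2) (![2 * j, 2 * (k - j), e] 2 - 1) = 0 := by
    intro j
    change dunklCoeff (μ 2) e * dunklCoeff (μ 2) (e - 1) = 0
    interval_cases e <;> simp [dunklCoeff_zero]
  have hu0 : ∀ j, Function.update ![2 * j, 2 * (k - j), e] 0 (2 * j - 2)
      = ![2 * j - 2, 2 * (k - j), e] := by
    intro j; ext i; fin_cases i <;> rfl
  have hu1 : ∀ j, Function.update ![2 * j, 2 * (k - j), e] 1 (2 * (k - j) - 2)
      = ![2 * j, 2 * (k - j) - 2, e] := by
    intro j; ext i; fin_cases i <;> rfl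
  have e0 : ∑ j ∈ Finset.range (k + 1), harmCoeff μ k j * (evenCoeff (μ 0) j
        * mono ![2 * j - 2, 2 * (k - j), e] x)
      = ∑ j ∈ Finset.range k, harmCoeff μ k (j + 1) * (evenCoeff (μ 0) (j + 1)
        * mono ![2 * j, 2 * (k - j) - 2, e] x) := by
    rw [Finset.sum_range_succ', evenCoeff_zero, zero_mul, mul_zero, add_zero]
    refine Finset.sum_congr rfl fun j _ => ?_
    rw [show 2 * (j + 1) - 2 = 2 * j by omega, show 2 * (k - (j + 1)) = 2 * (k - j) - 2 by omega]
  have e1 : ∑ j ∈ Finset.range (k + 1), harmCoeff μ k j * (evenCoeff (μ 1) (k - j)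
        * mono ![2 * j, 2 * (k - j) - 2, e] x)
      = ∑ j ∈ Finset.range k, harmCoeff μ k j * (evenCoeff (μ 1) (k - j)
        * mono ![2 * j, 2 * (k - j) - 2, e] x) := by
    rw [Finset.sum_range_succ, Nat.sub_self, evenCoeff_zero, zero_mul, mul_zero, add_zero]
  have s2 : ∑ j ∈ Finset.range (k + 1), harmCoeff μ k j *
      (dunklCoeff (μ 2) (![2 * j, 2 * (k - j), e] 2)
      * dunklCoeff (μ 2) (![2 * j, 2 * (k - j), e] 2 - 1)
      * mono (Function.update ![2 * j, 2 * (k - j), e] 2 (![2 * j, 2 * (k - j), e] 2 - 2)) x) = 0 :=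
    Finset.sum_eq_zero fun j _ => by rw [hz j, zero_mul, mul_zero]
  rw [s2, add_zero]
  simp only [Matrix.cons_val_zero, Matrix.cons_val_one, hu0, hu1]
  change ∑ j ∈ Finset.range (k + 1), harmCoeff μ k j * (evenCoeff (μ 0) j
        * mono ![2 * j - 2, 2 * (k - j), e] x)
      + ∑ j ∈ Finset.range (k + 1), harmCoeff μ k j * (evenCoeff (μ 1) (k - j)
        * mono ![2 * j, 2 * (k - j) - 2, e] x) = 0
  rw [e0, e1, ← Finset.sum_add_distrib]
  refine Finset.sum_eq_zero fun j _ => ?_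
  have hne := evenCoeff_succ_ne_zero (hμ 0) j
  rw [harmCoeff]
  field_simp
  ring

/-- At a point of the unit sphere with vanishing first coordinate, only the term `j = 0`, of
coefficient `1`, survives. -/
lemma harm_ne_zero (μ : Fin 3 → ℝ) (k e : ℕ) :
    harm μ k e !₂[0, 3 / 5, 4 / 5] ≠ 0 := by
  have h : harm μ k e !₂[0, 3 / 5, 4 / 5] = (3 / 5 : ℂ) ^ (2 * k) * (4 / 5 : ℂ) ^ e := by
    unfold harm
    rw [Finset.sum_eq_single_of_mem 0 (by simp) fun j _ hj => by
      simp [mono, Fin.prod_univ_three, hj]]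
    simp [mono, Fin.prod_univ_three, harmCoeff]
  rw [h]
  exact mul_ne_zero (pow_ne_zero _ (by norm_num)) (pow_ne_zero _ (by norm_num))

theorem isEigenvalueS2_of_nat {μ : Fin 3 → ℝ} (hμ : ∀ i, -(1 / 2 : ℝ) < μ i) (n : WithTop ℕ∞)
    (N : ℕ) : IsEigenvalueS2 μ n (-(N : ℂ) * (N + 2 * ∑ i, (μ i : ℂ) + 1)) := by
  obtain ⟨k, e, he, rfl⟩ : ∃ k e, e ≤ 1 ∧ N = 2 * k + e :=
    ⟨N / 2, N % 2, by omega, by omega⟩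
  set N := 2 * k + e with hN
  refine ⟨fun ξ => harm μ k e ξ, ?_, ?_, fun ξ => ?_⟩
  · exact (contDiff_harm μ k e).contMDiff.comp contMDiff_coe_sphere
  · intro h
    have hm : (!₂[0, 3 / 5, 4 / 5] : E3) ∈ Metric.sphere (0 : E3) 1 := by
      rw [mem_sphere_zero_iff_norm, EuclideanSpace.norm_eq]
      simp [Fin.sum_univ_three]
      norm_num
    exact harm_ne_zero μ k e (congrFun h ⟨_, hm⟩)
  · have hξ : ‖(ξ : E3)‖ = 1 := by simp
    have hext : ∀ x : E3, ‖x‖ ∈ Ioi (0 : ℝ) → radialExt (fun ξ : S2 => harm μ k e ξ) x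
        = ((((‖x‖ ^ 2) ^ (-(N : ℝ) / 2) : ℝ)) : ℂ) * harm μ k e x := by
      intro x hx
      have hx' : 0 < ‖x‖ := hx
      rw [radialExt_of_ne_zero _ (norm_pos_iff.1 hx'), proj, harm_smul, ← hN]
      congr 1
      rw [← Complex.ofReal_pow, ← Real.rpow_natCast ‖x‖ 2, ← Real.rpow_mul hx'.le, inv_pow,
        ← Real.rpow_natCast, ← Real.rpow_neg hx'.le]
      congr 2
      push_cast
      ring
    have hd : ∀ c r : ℝ, ∀ t ∈ Ioi (0 : ℝ), HasDerivAt (fun t : ℝ => ((c * t ^ r : ℝ) : ℂ))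
        ((c * r * t ^ (r - 1) : ℝ) : ℂ) t := by
      intro c r t ht
      have := ((Real.hasDerivAt_rpow_const (p := r) (Or.inl (ne_of_gt ht))).const_mul c).ofReal_comp
      simpa [mul_assoc] using this
    have hs1 : (‖(ξ : E3)‖ ^ 2) ∈ Ioi (0 : ℝ) := by rw [hξ]; norm_num
    -- For `η t = t^(-N/2)` at `t = 1` the radial terms are `4 (N/2)(N/2 + 1) - N (2 N + 3 + 2 S) =
    -- -N (N + 2 S + 1)`.
    have key := dunklLaplacian_radial_mul μ isOpen_Ioi (hd 1 (-(N : ℝ) / 2))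
      (hd (1 * (-(N : ℝ) / 2)) (-(N : ℝ) / 2 - 1)) (contDiff_harm μ k e) hs1
      (fderiv_harm_self μ k e ξ)
    rw [dunklLaplacian_harm hμ k he, hξ] at key
    rw [dunklLaplacianS2, dunklLaplacian_congr μ isOpen_Ioi hext (by rw [hξ]; exact one_pos (α := ℝ))]
    simp only [one_mul, one_pow, Real.one_rpow] at key
    rw [key, ← hN]
    push_cast
    ring

end DunklSphere

end

/-! ### The spectrum -/

theorem proposition2 (μ : Fin 3 → ℝ) (hμ : ∀ i, -(1 / 2 : ℝ) < μ i)
    (n : WithTop ℕ∞) (hn : 2 ≤ n) :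
    {δ : ℂ | DunklSphere.IsEigenvalueS2 μ n δ} =
      Set.range fun N : ℕ =>
        (((-(N : ℝ)) * ((N : ℝ) + 2 * μ 0 + 2 * μ 1 + 2 * μ 2 + 1) : ℝ) : ℂ) := by
  have hval : ∀ N : ℕ, (((-(N : ℝ)) * ((N : ℝ) + 2 * μ 0 + 2 * μ 1 + 2 * μ 2 + 1) : ℝ) : ℂ)
      = -(N : ℂ) * (N + 2 * ∑ i, (μ i : ℂ) + 1) := by
    intro N
    rw [Fin.sum_univ_three]
    push_cast
    ring
  ext δ
  simp only [Set.mem_ofPred_eq, Set.mem_range, hval]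
  constructor
  · intro h
    obtain ⟨N, hN⟩ := DunklSphere.exists_eq_of_isEigenvalueS2 hμ hn h
    exact ⟨N, hN.symm⟩
  · rintro ⟨N, rfl⟩
    exact DunklSphere.isEigenvalueS2_of_nat hμ n N
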